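/- **Setting.** There are $n$ buyers and $m \ge 1$ items, item $j \in [m]$ being available in $k_j \ge 1$ copies; put $K = (k_1,\dots,k_m)$ and $k = \min_j k_j$. The valuations $v_i : 2^{[m]} \to \mathbb{R}_{\ge 0}$, $i \in [n]$, are drawn independently, $v_i \sim \mathcal{D}_i$, from known distributions. They are (almost surely) XOS (fractionally subadditive): $v$ is XOS if there is a set $\mathcal{A}^v \subseteq \mathbb{R}_{\ge 0}^m$ with $v(S) = \max_{a \in \mathcal{A}^v} \sum_{j \in S} a_j$ for all $S \subseteq [m]$. A *feasible solution of the ex-ante relaxation* is a family of numbers $x_{i,v_i,S} \ge 0$ (measurable in $v_i$) such that $$\sum_{i \in [n]} \sum_{S \ni j} \mathbb{E}_{v_i \sim \mathcal{D}_i}[x_{i,v_i,S}] \le k_j \quad (j \in [m]), \qquad \sum_{S \subseteq [m]} x_{i,v_i,S} \le 1 \quad (i \in [n],\ \mathcal{D}_i\text{-almost every } v_i).$$ Its *objective value* is $\sum_{i \in [n]} \sum_{S \subseteq [m]} \mathbb{E}_{v_i \sim \mathcal{D}_i}[v_i(S)\, x_{i,v_i,S}] \in [0,\infty]$. A (possibly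 randomized) *online allocation mechanism* $M$ serves the buyers one at a time. When a buyer arrives, $M$ learns who the buyer is and his valuation, and irrevocably gives him a set of items each of which still has a copy left (at most one copy of each item per buyer). The set may depend on the instance, on the identities and valuations of the buyers that have arrived so far, on the remaining supply and on the internal randomness of $M$, but not on the valuations or the order of the buyers still to come. The order of arrival is chosen by an adversary who knows $M$ and the whole realized profile $\mathbf{v} = (v_1,\dots,v_n)$, but not the internal randomness of $M$. If buyer $i$ receives $S_i$, the expected welfare of $M$ is $$\mathsf{Welfare}(M,\mathcal{D},K) = \mathbb{E}_{\mathbf{v}}\Big[\min_{\text{orders } \pi}\ \mathbb{E}\Big[\sum_{i \in [n]} v_i(S_i) \,\Big|\, \mathbf{v}, \pi\Big]\Big],$$ the inner expectation being over the internal randomness of $M$. **Theorem.** For every such instance $(\mathcal{D}, K)$ and every feasible solution $x$ of the ex-ante relaxation there is an online allocation mechanism $M$ with $$\mathsf{Welfare}(M,\mathcal{D},K) \;\ge\; \Big(1 - \frac{1}{\sqrt{k+3}}\Big) \sum_{i \in [n]} \sum_{S \subseteq [m]} \mathbb{E}_{v_i \sim \mathcal{D}_i}\big[v_i(S)\, x_{i,v_i,S}\big].$$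 -/

import Mathlib

open MeasureTheory
open scoped NNReal ENNReal

/-- A combinatorial valuation over `m` items: a nonnegative value for each set of items. -/
abbrev BuyerValuation (m : ℕ) : Type := Finset (Fin m) → ℝ≥0

/-- Fractionally subadditive (XOS): `v` is the pointwise (attained) maximum of a family of
nonnegative additive functions. -/
def IsXOS {m : ℕ} (v : BuyerValuation m) : Prop :=
  ∃ A : Set (Fin m → ℝ≥0), ∀ S : Finset (Fin m),
    IsGreatest ((fun a : Fin m → ℝ≥0 => ∑ j ∈ S, a j) '' A) (v S)

/-- `x i v S` is the probability with which buyer `i` receives the set `S` when his value is `v`.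
Feasibility for the ex-ante relaxation of the instance `(D, K)`. The bound `x i v S ≤ 1` follows
from `total_le_one`. -/
structure IsExAnteFeasible {n m : ℕ} (D : Fin n → Measure (BuyerValuation m)) (K : Fin m → ℕ)
    (x : Fin n → BuyerValuation m → Finset (Fin m) → ℝ≥0) : Prop where
  measurable : ∀ i S, Measurable fun v => x i v S
  supply : ∀ j, ∑ i, ∑ S : Finset (Fin m) with j ∈ S, ∫⁻ v, (x i v S : ℝ≥0∞) ∂(D i) ≤ K j
  total_le_one : ∀ i, ∀ᵐ v ∂(D i), ∑ S, x i v S ≤ 1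

/-- The objective of the ex-ante relaxation. -/
noncomputable def exAnteObjective {n m : ℕ} (D : Fin n → Measure (BuyerValuation m))
    (x : Fin n → BuyerValuation m → Finset (Fin m) → ℝ≥0) : ℝ≥0∞ :=
  ∑ i, ∑ S : Finset (Fin m), ∫⁻ v, (v S : ℝ≥0∞) * (x i v S : ℝ≥0∞) ∂(D i)

/-- A (randomized) online allocation mechanism for `n` buyers and `m` items.

Its internal randomness is a seed drawn from `law`. When the buyer in position `t`
(counted from `0`) arrives, it has seen the identities and the values of the buyers in the
positions `0, …, t`, and `R j` copies of item `j` remain; `alloc ω R h` is the set of items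
handed to the arriving buyer, of which at least one copy must remain. -/
structure OnlineMechanism (n m : ℕ) where
  Seed : Type
  [seedSpace : MeasurableSpace Seed]
  law : Measure Seed
  [isProbabilityMeasure_law : IsProbabilityMeasure law]
  alloc : Seed → (Fin m → ℕ) → {t : ℕ} → (Fin (t + 1) → Fin n × BuyerValuation m) → Finset (Fin m)
  alloc_available : ∀ (ω : Seed) (R : Fin m → ℕ) {t : ℕ} (h : Fin (t + 1) → Fin n × BuyerValuation m),
    ∀ j ∈ alloc ω R h, 0 < R j
  measurableSet_alloc : ∀ (R : Fin m → ℕ) (t : ℕ) (b : Fin (t + 1) → Fin n)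
    (T : Finset (Fin m)),
    MeasurableSet {p : Seed × (Fin (t + 1) → BuyerValuation m) |
      alloc p.1 R (fun s => (b s, p.2 s)) = T}

namespace OnlineMechanism

variable {n m : ℕ} (M : OnlineMechanism n m)

attribute [instance] OnlineMechanism.seedSpace OnlineMechanism.isProbabilityMeasure_law

/-- The set given to the buyer in position `t` if the supply `R` remains. The buyers arrive in the
order `π 0, π 1, …`, with the values `v`. -/
def serve (ω : M.Seed) (v : Fin n → BuyerValuation m) (π : Equiv.Perm (Fin n)) (R : Fin m → ℕ)
    (t : ℕ) (ht : t < n) : Finset (Fin m) :=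
  M.alloc ω R (fun s : Fin (t + 1) =>
    (π ⟨s, lt_of_lt_of_le s.isLt ht⟩, v (π ⟨s, lt_of_lt_of_le s.isLt ht⟩)))

/-- The supply that remains after the first `t` buyers have been served. -/
def remaining (K : Fin m → ℕ) (ω : M.Seed) (v : Fin n → BuyerValuation m)
    (π : Equiv.Perm (Fin n)) : (t : ℕ) → t ≤ n → Fin m → ℕ
  | 0, _ => K
  | t + 1, ht => fun j =>
      remaining K ω v π t (Nat.le_of_succ_le ht) j -
        if j ∈ M.serve ω v π (remaining K ω v π t (Nat.le_of_succ_le ht)) t ht then 1 else 0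

/-- The set received by the buyer in position `t`. -/
def bundle (K : Fin m → ℕ) (ω : M.Seed) (v : Fin n → BuyerValuation m)
    (π : Equiv.Perm (Fin n)) (t : Fin n) : Finset (Fin m) :=
  M.serve ω v π (M.remaining K ω v π t t.isLt.le) t t.isLt

/-- The social welfare of one run of the mechanism. -/
def runWelfare (K : Fin m → ℕ) (ω : M.Seed) (v : Fin n → BuyerValuation m)
    (π : Equiv.Perm (Fin n)) : ℝ≥0 :=
  ∑ t : Fin n, v (π t) (M.bundle K ω v π t)

/-- The expected social welfare of the mechanism on the instance `(D, K)`: the values are drawn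
independently, then an adversary who knows the mechanism and all the values, but not the
mechanism's internal randomness, picks the order of arrival that is worst for the expected
welfare. -/
noncomputable def welfare (D : Fin n → Measure (BuyerValuation m)) (K : Fin m → ℕ) : ℝ≥0∞ :=
  ∫⁻ v, ⨅ π : Equiv.Perm (Fin n), ∫⁻ ω, (M.runWelfare K ω v π : ℝ≥0∞) ∂M.law ∂(Measure.pi D)

end OnlineMechanism

/-! The items decouple. Each buyer, given the value `v`, draws a set `S` with probability `x i v S`
from a private seed, and an additive function below `v` that is tight at `S` puts a price on every
item of `S`. These prices turn the problem into one single-item problem per item: independent buyers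
with values `X`, where the probabilities of a nonzero value add up to at most the number of copies.
Whatever bundle is handed out is worth at least the sum of its prices, so single-item guarantees add
up (`exists_item_values`, `sum_acceptedValue_le_runWelfare`).

For one item with `k` copies, values are rounded to finitely many classes and sold under nested
booking limits: at most `θ p` units go to the classes up to `p`. The sets of requests that can be
served form a laminar matroid, and a request is accepted exactly if it raises the rank `soldBelow`.
Every order of arrival then yields a basis, and increasing order of value is the greedy order for a
basis of least value. Hence that order is the worst one (`valueBelow_le_accepted`), and the bound
holds for each realization separately, so the adversary's information is irrelevant.

In increasing order, the optimal policy is a dynamic program. Its opportunity costs increase with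
the units sold and decrease in time, while values increase, so the policy is itself one of nested
booking limits (`exists_limits`). Its value is at least that of Alaei's magician, which serves every
request with probability `γ` (`IsCostProcess.sum_ge`). Classes of the same buyer exclude each other,
which only helps (`le_lintegral_valueBelow`).

The magician works if `γ * ∑ j < k, γ ^ j ≤ k * (1 - γ)`. For `k ≥ 2` the constant `1 - 1 / √(k +
3)` satisfies this strictly, and the slack pays for the rounding. For `k = 1` there is no slack, and
the prophet inequality with the threshold at half the ex-ante value gives `1 / 2` without rounding.
-/

/-! ### Nested booking limits and the worst order of arrival -/

/-- Number of units sold to the classes below `p` when the requests are served in increasing order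
of class: `N p` requests have class `p`, and at most `θ p` units go to the classes up to `p`. -/
def soldBelow (θ N : ℕ → ℕ) : ℕ → ℕ
  | 0 => 0
  | p + 1 => min (θ p) (soldBelow θ N p + N p)

/-- Value of the units counted by `soldBelow`, a unit sold to class `p` counting `y p`. -/
def valueBelow (θ N : ℕ → ℕ) (y : ℕ → ℝ) (p : ℕ) : ℝ :=
  ∑ q ∈ Finset.range p, y q * ((soldBelow θ N (q + 1) : ℝ) - soldBelow θ N q)

/-- Number of the first `t` requests that have class `p`. -/
def classCount (g : ℕ → ℕ) (t p : ℕ) : ℕ := ((Finset.range t).filter fun s => g s = p).card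

/-- The request in position `t` is accepted if it increases the number of units sold. -/
def Accepts (θ : ℕ → ℕ) (T : ℕ) (g : ℕ → ℕ) (t : ℕ) : Prop :=
  soldBelow θ (classCount g t) T < soldBelow θ (classCount g (t + 1)) T

instance (θ : ℕ → ℕ) (T : ℕ) (g : ℕ → ℕ) (t : ℕ) : Decidable (Accepts θ T g t) :=
  inferInstanceAs (Decidable (_ < _))

lemma classCount_zero (g : ℕ → ℕ) (p : ℕ) : classCount g 0 p = 0 := by
  simp [classCount]

lemma classCount_succ (g : ℕ → ℕ) (t p : ℕ) :
    classCount g (t + 1) p = classCount g t p + if p = g t then 1 else 0 := by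
  unfold classCount
  rw [Finset.range_add_one, Finset.filter_insert]
  by_cases h : g t = p
  · rw [if_pos h, if_pos h.symm, Finset.card_insert_of_notMem (by simp)]
  · rw [if_neg h, if_neg (Ne.symm h), add_zero]

lemma classCount_congr {g g' : ℕ → ℕ} {t : ℕ} (h : ∀ s < t, g s = g' s) :
    classCount g t = classCount g' t := by
  funext p
  unfold classCount
  congr 1
  refine Finset.filter_congr fun s hs => ?_
  rw [h s (Finset.mem_range.1 hs)]

lemma soldBelow_le {θ : ℕ → ℕ} {k : ℕ} (hθ : ∀ p, θ p ≤ k) (N : ℕ → ℕ) (p : ℕ) :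
    soldBelow θ N p ≤ k := by
  cases p with
  | zero => exact Nat.zero_le _
  | succ p => exact (min_le_left _ _).trans (hθ p)

lemma soldBelow_le_limit {θ : ℕ → ℕ} (hθ : Monotone θ) (N : ℕ → ℕ) (p : ℕ) :
    soldBelow θ N p ≤ θ p := by
  cases p with
  | zero => exact Nat.zero_le _
  | succ p => exact (min_le_left _ _).trans (hθ p.le_succ)

lemma soldBelow_congr {θ N N' : ℕ → ℕ} {p : ℕ} (h : ∀ q < p, N q = N' q) :
    soldBelow θ N p = soldBelow θ N' p := by
  induction p with
  | zero => rfl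
  | succ p ih => simp only [soldBelow, ih fun q hq => h q (by omega), h p (by omega)]

lemma soldBelow_mono {θ N N' : ℕ → ℕ} (h : ∀ q, N q ≤ N' q) (p : ℕ) :
    soldBelow θ N p ≤ soldBelow θ N' p := by
  induction p with
  | zero => rfl
  | succ p ih =>
    have := h p
    simp only [soldBelow]
    omega

lemma soldBelow_zero (θ : ℕ → ℕ) (p : ℕ) : soldBelow θ (fun _ => 0) p = 0 := by
  induction p with
  | zero => rfl
  | succ p ih => simp [soldBelow, ih]

/-- Effect of an additional request of class `c`. -/
lemma soldBelow_add_request {θ N N' : ℕ → ℕ} {c : ℕ}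
    (hN : ∀ p, N' p = N p + if p = c then 1 else 0) {y : ℕ → ℝ} (hy : Monotone y) (p : ℕ) :
    soldBelow θ N p ≤ soldBelow θ N' p ∧ soldBelow θ N' p ≤ soldBelow θ N p + 1 ∧
      valueBelow θ N' y p + y c * soldBelow θ N p ≤
        valueBelow θ N y p + y c * soldBelow θ N' p ∧
      (p ≤ c → soldBelow θ N' p = soldBelow θ N p) := by
  induction p with
  | zero => simp [soldBelow, valueBelow]
  | succ p ih =>
    obtain ⟨h1, h2, h3, h4⟩ := ih
    have hNp := hN p
    have hv : ∀ M : ℕ → ℕ, valueBelow θ M y (p + 1) = valueBelow θ M y p +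
        y p * ((soldBelow θ M (p + 1) : ℝ) - soldBelow θ M p) := fun M =>
      Finset.sum_range_succ _ _
    refine ⟨?_, ?_, ?_, ?_⟩
    · simp only [soldBelow]; omega
    · simp only [soldBelow]
      split_ifs at hNp with hpc
      · have := h4 hpc.le; omega
      · omega
    · rw [hv, hv]
      rcases lt_trichotomy p c with hpc | hpc | hpc
      · have e1 := h4 hpc.le
        have e2 : soldBelow θ N' (p + 1) = soldBelow θ N (p + 1) := by
          simp only [soldBelow, e1, hNp, if_neg hpc.ne, add_zero]
        rw [e1] at h3 ⊢
        rw [e2]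
        linarith
      · subst hpc
        rw [h4 le_rfl] at h3 ⊢
        linarith
      -- Past class `c` the surplus unit can only disappear, by displacing a unit of class `p`,
      -- which is worth at least `y c`.
      · have e : soldBelow θ N' (p + 1) + soldBelow θ N p ≤
            soldBelow θ N (p + 1) + soldBelow θ N' p := by
          rw [if_neg hpc.ne'] at hNp
          simp only [soldBelow]; omega
        have e' : (soldBelow θ N' (p + 1) : ℝ) + soldBelow θ N p ≤
            soldBelow θ N (p + 1) + soldBelow θ N' p := by exact_mod_cast e
        nlinarith [hy hpc.le]
    · intro hpc
      have e1 := h4 (by omega)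
      simp only [soldBelow, e1, hNp, if_neg (by omega : p ≠ c), add_zero]

/-- The rank grows by at most one per request, so in any order of arrival the number of accepted
requests equals `soldBelow` of the class counts. -/
lemma soldBelow_classCount_succ (θ : ℕ → ℕ) (T : ℕ) (g : ℕ → ℕ) (t : ℕ) :
    soldBelow θ (classCount g (t + 1)) T =
      soldBelow θ (classCount g t) T + if Accepts θ T g t then 1 else 0 := by
  have h := soldBelow_add_request (θ := θ) (classCount_succ g t) (y := fun _ => 0)
    monotone_const T
  by_cases ha : Accepts θ T g t
  · have ha' := ha
    unfold Accepts at ha'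
    rw [if_pos ha]
    omega
  · have ha' := ha
    unfold Accepts at ha'
    rw [if_neg ha]
    omega

/-- Whatever the order of arrival, the accepted requests are worth at least as much as those
accepted when the requests arrive in increasing order of class. -/
lemma valueBelow_le_accepted {θ : ℕ → ℕ} {T : ℕ} {g : ℕ → ℕ} {y : ℕ → ℝ} (hy : Monotone y)
    {X : ℕ → ℝ} (hX : ∀ s, g s < T → y (g s) ≤ X s) (t : ℕ) :
    valueBelow θ (classCount g t) y T ≤
      ∑ s ∈ Finset.range t, if Accepts θ T g s then X s else 0 := by
  induction t with
  | zero =>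
    have : classCount g 0 = fun _ => 0 := funext (classCount_zero g)
    simp [valueBelow, this, soldBelow_zero]
  | succ t ih =>
    rw [Finset.sum_range_succ]
    obtain ⟨h1, h2, h3, h4⟩ := soldBelow_add_request (θ := θ) (classCount_succ g t) hy T
    have h5 := soldBelow_classCount_succ θ T g t
    split_ifs with ha
    · rw [if_pos ha] at h5
      have hlt : g t < T := by
        by_contra hcon
        have := h4 (not_lt.1 hcon)
        omega
      have h6 : (soldBelow θ (classCount g (t + 1)) T : ℝ) =
        soldBelow θ (classCount g t) T + 1 := by exact_mod_cast h5
      rw [h6] at h3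
      linarith [hX t hlt]
    · rw [if_neg ha, add_zero] at h5
      rw [h5] at h3
      linarith

/-- If one unit is for sale to class `0` only, then some request of class `0` is accepted. -/
lemma exists_accepted_of_single_class {g : ℕ → ℕ} {n : ℕ} (h : ∃ s < n, g s = 0) :
    ∃ s < n, g s = 0 ∧ Accepts (fun _ => 1) 1 g s := by
  classical
  obtain ⟨hs, hs0⟩ := Nat.find_spec h
  refine ⟨Nat.find h, hs, hs0, ?_⟩
  have hz : classCount g (Nat.find h) 0 = 0 := by
    unfold classCount
    rw [Finset.card_eq_zero, Finset.filter_eq_empty_iff]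
    intro s hsr hs'
    have hsr := Finset.mem_range.1 hsr
    exact Nat.find_min h hsr ⟨hsr.trans hs, hs'⟩
  have h1 := classCount_succ g (Nat.find h) 0
  rw [hz, if_pos hs0.symm] at h1
  simp [Accepts, soldBelow, hz, h1]

/-! ### The dynamic program for requests in increasing order of value -/

/-- Gain from selling a unit at price `y` when `ℓ` of `k` units have been sold and the next one
has the opportunity cost `d ℓ`. -/
noncomputable def saleGain (k : ℕ) (y : ℝ) (d : ℕ → ℝ) (ℓ : ℕ) : ℝ :=
  if ℓ < k then max (y - d ℓ) 0 else 0

/-- Opportunity costs one step earlier, when a request of value `y` arrives with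
probability `x`. -/
noncomputable def costStep (k : ℕ) (x y : ℝ) (d : ℕ → ℝ) (ℓ : ℕ) : ℝ :=
  d ℓ + x * saleGain k y d ℓ - x * saleGain k y d (ℓ + 1)

lemma saleGain_nonneg (k : ℕ) (y : ℝ) (d : ℕ → ℝ) (ℓ : ℕ) : 0 ≤ saleGain k y d ℓ := by
  unfold saleGain; split_ifs <;> simp

lemma saleGain_antitone {k : ℕ} (y : ℝ) {d : ℕ → ℝ} (hd : ∀ ℓ, ℓ + 1 < k → d ℓ ≤ d (ℓ + 1)) :
    Antitone (saleGain k y d) := by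
  refine antitone_nat_of_succ_le fun ℓ => ?_
  by_cases h : ℓ + 1 < k
  · have := hd ℓ h
    simp only [saleGain, if_pos h, if_pos (Nat.lt_of_succ_lt h)]
    exact max_le_max (by linarith) le_rfl
  · rw [saleGain, if_neg h]
    exact saleGain_nonneg _ _ _ _

/-- Opportunity costs for a sequence of requests of value `y t` arriving with probability `x t`;
there are none from time `T` on. -/
structure IsCostProcess (k : ℕ) (x y : ℕ → ℝ) (T : ℕ) (d : ℕ → ℕ → ℝ) : Prop where
  final : ∀ ℓ, d T ℓ = 0
  step : ∀ t < T, ∀ ℓ, d t ℓ = costStep k (x t) (y t) (d (t + 1)) ℓ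

lemma exists_isCostProcess (k : ℕ) (x y : ℕ → ℝ) (T : ℕ) : ∃ d, IsCostProcess k x y T d := by
  -- Backward recursion: `j` counts the steps back from `T`.
  let e : ℕ → ℕ → ℝ := fun j => Nat.rec (fun _ => 0)
    (fun j D => costStep k (x (T - 1 - j)) (y (T - 1 - j)) D) j
  refine ⟨fun t => e (T - t), fun ℓ => by simp [e], fun t ht ℓ => ?_⟩
  obtain ⟨j, rfl⟩ := Nat.exists_eq_add_of_lt ht
  have h1 : t + j + 1 - t = j + 1 := by omega
  have h2 : t + j + 1 - (t + 1) = j := by omega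
  have h3 : t + j + 1 - 1 - j = t := by omega
  simp only [h1, h2]
  change costStep k (x (t + j + 1 - 1 - j)) (y (t + j + 1 - 1 - j)) (e j) ℓ = _
  rw [h3]

namespace IsCostProcess

variable {k : ℕ} {x y : ℕ → ℝ} {T : ℕ} {d : ℕ → ℕ → ℝ}

/-- Concavity of the value function in the remaining supply. For `ℓ < k`, cost plus gain is `max y
d`, which is monotone in the cost, and the subtracted gain is antitone in `ℓ`; a step of the
recursion therefore preserves the order. -/
lemma le_succ (h : IsCostProcess k x y T d) (hx0 : ∀ t, 0 ≤ x t) (hx1 : ∀ t, x t ≤ 1)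
    {t : ℕ} (ht : t ≤ T) : ∀ ℓ, ℓ + 1 < k → d t ℓ ≤ d t (ℓ + 1) := by
  induction ht using Nat.decreasingInduction with
  | self => intro ℓ _; rw [h.final, h.final]
  | of_succ t ht ih =>
    intro ℓ hℓ
    rw [h.step t ht, h.step t ht]
    unfold costStep
    have h1 := ih ℓ hℓ
    have h2 := saleGain_antitone (y t) ih (Nat.le_succ (ℓ + 1))
    have h3 : (1 - x t) * d (t + 1) ℓ + x t * (d (t + 1) ℓ + saleGain k (y t) (d (t + 1)) ℓ) ≤
        (1 - x t) * d (t + 1) (ℓ + 1) +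
          x t * (d (t + 1) (ℓ + 1) + saleGain k (y t) (d (t + 1)) (ℓ + 1)) := by
      refine add_le_add (mul_le_mul_of_nonneg_left h1 (by linarith [hx1 t]))
        (mul_le_mul_of_nonneg_left ?_ (hx0 t))
      simp only [saleGain, if_pos hℓ, if_pos (Nat.lt_of_succ_lt hℓ)]
      rcases max_cases (y t - d (t + 1) ℓ) 0 with ⟨e, _⟩ | ⟨e, _⟩ <;>
      rcases max_cases (y t - d (t + 1) (ℓ + 1)) 0 with ⟨e', _⟩ | ⟨e', _⟩ <;>
      rw [e, e'] <;> linarith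
    have h4 := mul_le_mul_of_nonneg_left h2 (hx0 t)
    simp only [Nat.succ_eq_add_one] at h4
    linarith

lemma succ_le (h : IsCostProcess k x y T d) (hx0 : ∀ t, 0 ≤ x t) (hx1 : ∀ t, x t ≤ 1)
    {t : ℕ} (ht : t < T) (ℓ : ℕ) : d (t + 1) ℓ ≤ d t ℓ := by
  rw [h.step t ht]
  unfold costStep
  have := mul_le_mul_of_nonneg_left
    (saleGain_antitone (y t) (h.le_succ hx0 hx1 (Nat.succ_le_of_lt ht)) ℓ.le_succ) (hx0 t)
  simp only [Nat.succ_eq_add_one] at this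
  linarith

lemma nonneg (h : IsCostProcess k x y T d) (hx0 : ∀ t, 0 ≤ x t) (hx1 : ∀ t, x t ≤ 1)
    {t : ℕ} (ht : t ≤ T) (ℓ : ℕ) : 0 ≤ d t ℓ := by
  induction ht using Nat.decreasingInduction with
  | self => rw [h.final]
  | of_succ t ht ih => exact ih.trans (h.succ_le hx0 hx1 ht ℓ)

/-- Booking limits: sell at time `t` exactly if the value is at least the opportunity cost. -/
lemma exists_limits (h : IsCostProcess k x y T d) (hx0 : ∀ t, 0 ≤ x t) (hx1 : ∀ t, x t ≤ 1)
    (hy : Monotone y) : ∃ θ : ℕ → ℕ, Monotone θ ∧ (∀ t, θ t ≤ k) ∧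
      ∀ t < T, ∀ s, s < θ t ↔ s < k ∧ d (t + 1) s ≤ y t := by
  classical
  -- From `T` on the limit is set to `k`, which keeps `θ` monotone; those classes are never served.
  have key : ∀ t, ∃ j ≤ k, (T ≤ t → j = k) ∧
      (t < T → ∀ s, s < j ↔ s < k ∧ d (t + 1) s ≤ y t) := by
    intro t
    rcases le_or_gt T t with ht | ht
    · exact ⟨k, le_rfl, fun _ => rfl, fun h => by omega⟩
    have hex : ∃ j, ¬ (j < k ∧ d (t + 1) j ≤ y t) := ⟨k, by simp⟩
    have hjk : Nat.find hex ≤ k := Nat.find_min' hex (by simp)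
    refine ⟨Nat.find hex, hjk, fun h => by omega, fun _ s => ⟨fun hs => ?_, fun hs => ?_⟩⟩
    · exact not_not.1 (Nat.find_min hex hs)
    · by_contra hcon
      refine Nat.find_spec hex ⟨(not_lt.1 hcon).trans_lt hs.1, le_trans ?_ hs.2⟩
      have hm : ∀ i, Nat.find hex ≤ i → i < k → d (t + 1) (Nat.find hex) ≤ d (t + 1) i := by
        intro i hi
        induction i, hi using Nat.le_induction with
        | base => intro _; rfl
        | succ i hi ih =>
          intro hik
          exact (ih (by omega)).trans (h.le_succ hx0 hx1 ht i hik)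
      exact hm s (not_lt.1 hcon) hs.1
  choose θ hθk hθT hθ using key
  refine ⟨θ, monotone_nat_of_le_succ fun t => ?_, hθk, hθ⟩
  rcases le_or_gt T (t + 1) with ht | ht
  · rw [hθT (t + 1) ht]; exact hθk t
  · refine le_of_forall_lt fun s hs => ?_
    rw [hθ t (by omega)] at hs
    rw [hθ (t + 1) ht]
    exact ⟨hs.1, (h.succ_le hx0 hx1 ht s).trans (hs.2.trans (hy t.le_succ))⟩

/-- The Bellman equation: the sum of `d t ℓ` over `s ≤ ℓ < k` is the optimal value from time `t` on
with `s` units already sold. The differences of gains telescope, and the gain vanishes at `k`. -/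
lemma sum_Ico (h : IsCostProcess k x y T d) {t : ℕ} (ht : t < T) {s : ℕ} (hs : s ≤ k) :
    ∑ ℓ ∈ Finset.Ico s k, d t ℓ =
      ∑ ℓ ∈ Finset.Ico s k, d (t + 1) ℓ + x t * saleGain k (y t) (d (t + 1)) s := by
  have h1 : ∀ ℓ, d t ℓ = d (t + 1) ℓ - (x t * saleGain k (y t) (d (t + 1)) (ℓ + 1) -
      x t * saleGain k (y t) (d (t + 1)) ℓ) := fun ℓ => by
    rw [h.step t ht]; unfold costStep; ring
  rw [Finset.sum_congr rfl fun ℓ _ => h1 ℓ, Finset.sum_sub_distrib,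
    Finset.sum_Ico_eq_sub _ hs, Finset.sum_Ico_eq_sub _ hs,
    Finset.sum_range_sub fun ℓ => x t * saleGain k (y t) (d (t + 1)) ℓ,
    Finset.sum_range_sub fun ℓ => x t * saleGain k (y t) (d (t + 1)) ℓ]
  have : saleGain k (y t) (d (t + 1)) k = 0 := by simp [saleGain]
  rw [this]
  ring

/-- Accounting identity along one realization; `N t ≤ 1` requests arrive at time `t`. -/
lemma value_add_sum (h : IsCostProcess k x y T d) {θ : ℕ → ℕ} (hθm : Monotone θ)
    (hθk : ∀ t, θ t ≤ k) (hθ : ∀ t < T, ∀ s, s < θ t ↔ s < k ∧ d (t + 1) s ≤ y t)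
    {N : ℕ → ℕ} (hN : ∀ t < T, N t ≤ 1) :
    valueBelow θ N y T +
        ∑ t ∈ Finset.range T, x t * saleGain k (y t) (d (t + 1)) (soldBelow θ N t) =
      ∑ ℓ ∈ Finset.range k, d 0 ℓ +
        ∑ t ∈ Finset.range T, N t * saleGain k (y t) (d (t + 1)) (soldBelow θ N t) := by
  have key : ∀ t ≤ T, valueBelow θ N y t + ∑ ℓ ∈ Finset.Ico (soldBelow θ N t) k, d t ℓ +
        ∑ q ∈ Finset.range t, x q * saleGain k (y q) (d (q + 1)) (soldBelow θ N q) =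
      ∑ ℓ ∈ Finset.range k, d 0 ℓ +
        ∑ q ∈ Finset.range t, N q * saleGain k (y q) (d (q + 1)) (soldBelow θ N q) := by
    intro t
    induction t with
    | zero => intro _; simp [valueBelow, soldBelow]
    | succ t ih =>
      intro ht
      have ih := ih (by omega)
      rw [h.sum_Ico (by omega) (soldBelow_le hθk N t)] at ih
      rw [Finset.sum_range_succ, Finset.sum_range_succ, valueBelow, Finset.sum_range_succ,
        ← valueBelow]
      have h1 := hθ t (by omega) (soldBelow θ N t)
      have h2 := soldBelow_le_limit hθm N t
      have h3 := hN t (by omega)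
      suffices hs : y t * ((soldBelow θ N (t + 1) : ℝ) - soldBelow θ N t) +
          ∑ ℓ ∈ Finset.Ico (soldBelow θ N (t + 1)) k, d (t + 1) ℓ =
          ∑ ℓ ∈ Finset.Ico (soldBelow θ N t) k, d (t + 1) ℓ +
            N t * saleGain k (y t) (d (t + 1)) (soldBelow θ N t) by linarith
      by_cases hlt : soldBelow θ N t < θ t
      · obtain ⟨hk, hd⟩ := h1.1 hlt
        have h4 : soldBelow θ N (t + 1) = soldBelow θ N t + N t := by
          simp only [soldBelow]; omega
        rw [h4, saleGain, if_pos hk, max_eq_left (by linarith)]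
        interval_cases hNt : N t
        · simp
        · rw [Finset.sum_eq_sum_Ico_succ_bot hk]
          push_cast
          ring
      · have h4 : soldBelow θ N (t + 1) = soldBelow θ N t := by
          simp only [soldBelow]; omega
        have h5 : saleGain k (y t) (d (t + 1)) (soldBelow θ N t) = 0 := by
          unfold saleGain
          split_ifs with hk
          · refine max_eq_right ?_
            by_contra hcon
            exact hlt (h1.2 ⟨hk, by linarith⟩)
          · rfl
        rw [h4, h5]
        ring
  have := key T le_rfl
  rw [Finset.sum_eq_zero (s := Finset.Ico _ _) fun ℓ _ => h.final ℓ, add_zero] at this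
  exact this

end IsCostProcess

/-! ### Alaei's magician as a lower bound for the dynamic program -/

/-- `F (ℓ - 1)`, with the value `0` at `ℓ = 0`. -/
def shiftRight (F : ℕ → ℝ) : ℕ → ℝ
  | 0 => 0
  | ℓ + 1 => F ℓ

lemma sum_range_mul_sub_succ (F h : ℕ → ℝ) (j : ℕ) :
    ∑ ℓ ∈ Finset.range j, F ℓ * (h ℓ - h (ℓ + 1)) =
      ∑ ℓ ∈ Finset.range j, (F ℓ - shiftRight F ℓ) * h ℓ - shiftRight F j * h j := by
  induction j with
  | zero => simp [shiftRight]
  | succ j ih => rw [Finset.sum_range_succ, Finset.sum_range_succ, ih, shiftRight]; ring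

lemma sum_range_sub_shiftRight (F : ℕ → ℝ) (j : ℕ) :
    ∑ ℓ ∈ Finset.range j, (F ℓ - shiftRight F ℓ) = shiftRight F j := by
  induction j with
  | zero => simp [shiftRight]
  | succ j ih => rw [Finset.sum_range_succ, ih, shiftRight]; ring

/-- The conservative magician of Alaei: `F` is the distribution function of the number of units
sold, the leftmost `γ` of the mass reaches up to `θ`, and `D` is the expected number of requests
so far. -/
structure MagicianState (k : ℕ) (γ : ℝ) (F : ℕ → ℝ) (θ : ℕ) (D : ℝ) : Prop where
  lt : θ < k
  nonneg : ∀ ℓ, 0 ≤ F ℓ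
  decay : ∀ ℓ < θ, F ℓ ≤ γ * F (ℓ + 1)
  ge : γ ≤ F θ
  le_one : F θ ≤ 1
  tail : ∀ ℓ, θ < ℓ → F ℓ = 1
  mean : ∑ ℓ ∈ Finset.range k, (1 - F ℓ) = γ * D

/-- The mass at `ℓ` that is selected to accept the next request. -/
def selected (γ : ℝ) (F : ℕ → ℝ) (θ ℓ : ℕ) : ℝ :=
  if ℓ < θ then F ℓ - shiftRight F ℓ else if ℓ = θ then γ - shiftRight F ℓ else 0

namespace MagicianState

variable {k : ℕ} {γ : ℝ} {F : ℕ → ℝ} {θ : ℕ} {D : ℝ}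

lemma shiftRight_nonneg (h : MagicianState k γ F θ D) (ℓ : ℕ) : 0 ≤ shiftRight F ℓ := by
  cases ℓ with
  | zero => exact le_rfl
  | succ ℓ => exact h.nonneg ℓ

lemma shiftRight_le (h : MagicianState k γ F θ D) (hγ0 : 0 ≤ γ) {ℓ : ℕ} (hℓ : ℓ ≤ θ) :
    shiftRight F ℓ ≤ γ * F ℓ := by
  cases ℓ with
  | zero => exact mul_nonneg hγ0 (h.nonneg 0)
  | succ ℓ => exact h.decay ℓ hℓ

lemma shiftRight_self_le (h : MagicianState k γ F θ D) (hγ0 : 0 ≤ γ) : shiftRight F θ ≤ γ := by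
  have := h.shiftRight_le hγ0 le_rfl
  nlinarith [h.le_one]

lemma selected_nonneg (h : MagicianState k γ F θ D) (hγ0 : 0 ≤ γ) (hγ1 : γ ≤ 1) (ℓ : ℕ) :
    0 ≤ selected γ F θ ℓ := by
  unfold selected
  split_ifs with h1 h2
  · have := h.shiftRight_le hγ0 h1.le
    nlinarith [h.nonneg ℓ]
  · subst h2
    linarith [h.shiftRight_self_le hγ0]
  · exact le_rfl

lemma selected_le (h : MagicianState k γ F θ D) (ℓ : ℕ) :
    selected γ F θ ℓ ≤ F ℓ - shiftRight F ℓ := by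
  unfold selected
  split_ifs with h1 h2
  · exact le_rfl
  · subst h2
    linarith [h.ge]
  · obtain ⟨j, rfl⟩ := Nat.exists_eq_succ_of_ne_zero (show ℓ ≠ 0 by omega)
    rw [h.tail _ (by omega)]
    simp only [shiftRight]
    rcases (show θ = j ∨ θ < j by omega) with rfl | h3
    · linarith [h.le_one]
    · rw [h.tail _ h3]; simp

lemma sum_selected (h : MagicianState k γ F θ D) :
    ∑ ℓ ∈ Finset.range k, selected γ F θ ℓ = γ := by
  have hsub : Finset.range (θ + 1) ⊆ Finset.range k := by
    intro i; have := h.lt; simp only [Finset.mem_range]; omega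
  have h1 : ∑ ℓ ∈ Finset.range (θ + 1), selected γ F θ ℓ =
      ∑ ℓ ∈ Finset.range k, selected γ F θ ℓ := by
    refine Finset.sum_subset hsub fun ℓ _ hℓ => ?_
    have : θ < ℓ := by simpa using hℓ
    simp [selected, this.ne', not_lt.2 this.le]
  have h2 : ∑ ℓ ∈ Finset.range θ, selected γ F θ ℓ = shiftRight F θ := by
    rw [← sum_range_sub_shiftRight]
    exact Finset.sum_congr rfl fun ℓ hℓ => by simp [selected, Finset.mem_range.1 hℓ]
  rw [← h1, Finset.sum_range_succ, h2]
  simp [selected]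

/-- If the number of units sold has distribution function `F`, then `∑ F ℓ * d ℓ` is the expected
optimal value to come. The magician moves the mass `x * selected` one unit up and earns `γ * x * y`;
the optimal decision at each state does at least as well. Summation by parts turns the differences
of gains into gains weighted by the point masses `F ℓ - F (ℓ - 1)`, which dominate `selected`. -/
lemma sum_mul_costStep_ge (h : MagicianState k γ F θ D) (hγ0 : 0 ≤ γ) (hγ1 : γ ≤ 1) {x : ℝ}
    (hx0 : 0 ≤ x) (y : ℝ) (d : ℕ → ℝ) :
    γ * (x * y) + ∑ ℓ ∈ Finset.range k, (F ℓ - x * selected γ F θ ℓ) * d ℓ ≤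
      ∑ ℓ ∈ Finset.range k, F ℓ * costStep k x y d ℓ := by
  have h1 : ∑ ℓ ∈ Finset.range k, F ℓ * costStep k x y d ℓ =
      ∑ ℓ ∈ Finset.range k, F ℓ * d ℓ +
        x * ∑ ℓ ∈ Finset.range k, F ℓ * (saleGain k y d ℓ - saleGain k y d (ℓ + 1)) := by
    rw [Finset.mul_sum, ← Finset.sum_add_distrib]
    refine Finset.sum_congr rfl fun ℓ _ => ?_
    unfold costStep; ring
  have h2 : saleGain k y d k = 0 := by simp [saleGain]
  have h3 : ∑ ℓ ∈ Finset.range k, selected γ F θ ℓ * (y - d ℓ) ≤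
      ∑ ℓ ∈ Finset.range k, (F ℓ - shiftRight F ℓ) * saleGain k y d ℓ := by
    refine Finset.sum_le_sum fun ℓ hℓ => ?_
    have h4 : y - d ℓ ≤ saleGain k y d ℓ := by
      rw [saleGain, if_pos (Finset.mem_range.1 hℓ)]; exact le_max_left _ _
    exact (mul_le_mul_of_nonneg_left h4 (h.selected_nonneg hγ0 hγ1 ℓ)).trans
      (mul_le_mul_of_nonneg_right (h.selected_le ℓ) (saleGain_nonneg _ _ _ _))
  have h5 : ∑ ℓ ∈ Finset.range k, selected γ F θ ℓ * (y - d ℓ) =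
      γ * y - ∑ ℓ ∈ Finset.range k, selected γ F θ ℓ * d ℓ := by
    simp only [mul_sub, Finset.sum_sub_distrib, ← Finset.sum_mul, h.sum_selected]
  have h6 : ∑ ℓ ∈ Finset.range k, (F ℓ - x * selected γ F θ ℓ) * d ℓ =
      ∑ ℓ ∈ Finset.range k, F ℓ * d ℓ - x * ∑ ℓ ∈ Finset.range k, selected γ F θ ℓ * d ℓ := by
    rw [Finset.mul_sum, ← Finset.sum_sub_distrib]
    exact Finset.sum_congr rfl fun ℓ _ => by ring
  rw [h1, sum_range_mul_sub_succ, h2, h6]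
  rw [h5] at h3
  nlinarith [mul_le_mul_of_nonneg_left h3 hx0]

/-- The magician never runs out of units. -/
lemma next (h : MagicianState k γ F θ D) (hγ0 : 0 < γ) (hγ1 : γ ≤ 1)
    (hγ : γ * ∑ j ∈ Finset.range k, γ ^ j ≤ k * (1 - γ)) {x : ℝ} (hx0 : 0 ≤ x) (hx1 : x ≤ 1)
    (hD : D + x ≤ k) :
    ∃ θ', MagicianState k γ (fun ℓ => F ℓ - x * selected γ F θ ℓ) θ' (D + x) := by
  set F' : ℕ → ℝ := fun ℓ => F ℓ - x * selected γ F θ ℓ with hF'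
  have hle : ∀ ℓ, F' ℓ ≤ F ℓ := fun ℓ => by
    have := mul_nonneg hx0 (h.selected_nonneg hγ0.le hγ1 ℓ)
    simp only [hF']; linarith
  have hnonneg : ∀ ℓ, 0 ≤ F' ℓ := fun ℓ => by
    have h1 := mul_le_mul_of_nonneg_right hx1 (h.selected_nonneg hγ0.le hγ1 ℓ)
    have h2 := h.selected_le ℓ
    have h3 := h.shiftRight_nonneg ℓ
    simp only [hF']; linarith
  have htail : ∀ ℓ, θ < ℓ → F' ℓ = 1 := fun ℓ hℓ => by
    simp [hF', selected, hℓ.ne', not_lt.2 hℓ.le, h.tail ℓ hℓ]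
  have hlow : ∀ ℓ, ℓ < θ → F' ℓ = (1 - x) * F ℓ + x * shiftRight F ℓ := fun ℓ hℓ => by
    simp only [hF', selected, if_pos hℓ]; ring
  have hat : F' θ = F θ - x * (γ - shiftRight F θ) := by simp [hF', selected]
  have hdecay : ∀ ℓ < θ, F' ℓ ≤ γ * F' (ℓ + 1) := fun ℓ hℓ => by
    have h1 : F' ℓ ≤ (1 - x) * F ℓ + x * (γ * F ℓ) := by
      rw [hlow ℓ hℓ]
      exact add_le_add le_rfl (mul_le_mul_of_nonneg_left (h.shiftRight_le hγ0.le hℓ.le) hx0)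
    have h2 := mul_le_mul_of_nonneg_left (h.decay ℓ hℓ) (sub_nonneg.2 hx1)
    rcases (show ℓ + 1 < θ ∨ ℓ + 1 = θ by omega) with h3 | h3
    · rw [hlow _ h3]
      simp only [shiftRight]
      linarith
    · subst h3
      rw [hat]
      simp only [shiftRight]
      have h4 := mul_le_mul_of_nonneg_left (mul_le_mul_of_nonneg_left h.ge hγ0.le) hx0
      linarith
  have hmean : ∑ ℓ ∈ Finset.range k, (1 - F' ℓ) = γ * (D + x) := by
    have : ∀ ℓ, 1 - F' ℓ = (1 - F ℓ) + x * selected γ F θ ℓ := fun ℓ => by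
      simp only [hF']; ring
    simp only [this, Finset.sum_add_distrib, ← Finset.mul_sum, h.mean, h.sum_selected]
    ring
  rcases le_or_gt γ (F' θ) with hc | hc
  · exact ⟨θ, h.lt, hnonneg, hdecay, hc, (hle θ).trans h.le_one, htail, hmean⟩
  have hone : F' (θ + 1) = 1 := htail _ (Nat.lt_succ_self _)
  refine ⟨θ + 1, ?_, hnonneg, fun ℓ hℓ => ?_, by rw [hone]; exact hγ1, hone.le,
    fun ℓ hℓ => htail ℓ (by omega), hmean⟩
  · by_contra hcon
    have hk : k = θ + 1 := by have := h.lt; omega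
    have hpow : ∀ j ≤ θ, F' (θ - j) ≤ γ ^ j * F' θ := by
      intro j
      induction j with
      | zero => simp
      | succ j ih =>
        intro hj
        have h1 := hdecay (θ - (j + 1)) (by omega)
        rw [show θ - (j + 1) + 1 = θ - j by omega] at h1
        have h2 := mul_le_mul_of_nonneg_left (ih (by omega)) hγ0.le
        rw [pow_succ]
        linarith
    have hsum : ∑ ℓ ∈ Finset.range k, F' ℓ ≤ F' θ * ∑ j ∈ Finset.range k, γ ^ j := by
      rw [← Finset.sum_range_reflect, Finset.mul_sum]
      refine Finset.sum_le_sum fun j hj => ?_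
      have := Finset.mem_range.1 hj
      rw [show k - 1 - j = θ - j by omega, mul_comm]
      exact hpow j (by omega)
    have hpos : 0 < ∑ j ∈ Finset.range k, γ ^ j :=
      Finset.sum_pos (fun j _ => pow_pos hγ0 j) (by rw [hk]; simp)
    have h1 := mul_lt_mul_of_pos_right hc hpos
    have h2 := mul_le_mul_of_nonneg_left hD hγ0.le
    simp only [Finset.sum_sub_distrib, Finset.sum_const, Finset.card_range, nsmul_eq_mul,
      mul_one] at hmean
    linarith
  · rcases (show ℓ < θ ∨ ℓ = θ by omega) with h1 | rfl
    · exact hdecay ℓ h1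
    · rw [hone, mul_one]; exact hc.le

end MagicianState

/-- The opportunity cost of all `k` units is at least `γ` times the ex-ante value. -/
lemma IsCostProcess.sum_ge {k : ℕ} {x y : ℕ → ℝ} {T : ℕ} {d : ℕ → ℕ → ℝ}
    (h : IsCostProcess k x y T d) (hx0 : ∀ t, 0 ≤ x t) (hx1 : ∀ t, x t ≤ 1)
    (hxk : ∑ t ∈ Finset.range T, x t ≤ k) (hk : 0 < k) {γ : ℝ} (hγ0 : 0 < γ) (hγ1 : γ ≤ 1)
    (hγ : γ * ∑ j ∈ Finset.range k, γ ^ j ≤ k * (1 - γ)) :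
    γ * ∑ t ∈ Finset.range T, x t * y t ≤ ∑ ℓ ∈ Finset.range k, d 0 ℓ := by
  -- Running the magician, its earnings plus the expected optimal value to come never exceed the
  -- initial optimum; at `T` nothing is to come.
  have key : ∀ t ≤ T, ∃ F θ, MagicianState k γ F θ (∑ q ∈ Finset.range t, x q) ∧
      γ * ∑ q ∈ Finset.range t, x q * y q + ∑ ℓ ∈ Finset.range k, F ℓ * d t ℓ ≤
        ∑ ℓ ∈ Finset.range k, d 0 ℓ := by
    intro t
    induction t with
    | zero =>
      intro _
      exact ⟨fun _ => 1, 0, ⟨hk, fun _ => zero_le_one, fun ℓ hℓ => by omega, hγ1, le_rfl,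
        fun _ _ => rfl, by simp⟩, by simp⟩
    | succ t ih =>
      intro ht
      obtain ⟨F, θ, hF, hle⟩ := ih (by omega)
      have hD : ∑ q ∈ Finset.range t, x q + x t ≤ k := by
        rw [← Finset.sum_range_succ]
        exact (Finset.sum_le_sum_of_subset_of_nonneg (Finset.range_mono ht)
          fun q _ _ => hx0 q).trans hxk
      obtain ⟨θ', hθ'⟩ := hF.next hγ0 hγ1 hγ (hx0 t) (hx1 t) hD
      refine ⟨_, θ', by rw [Finset.sum_range_succ]; exact hθ', ?_⟩
      have h1 := hF.sum_mul_costStep_ge hγ0.le hγ1 (hx0 t) (y t) (d (t + 1))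
      simp only [← h.step t (by omega)] at h1
      rw [Finset.sum_range_succ]
      linarith
  obtain ⟨F, θ, -, hle⟩ := key T le_rfl
  simpa [h.final] using hle

/-- The magician's guarantee, with room to spare for at least two units. -/
lemma exists_gt_magician {k : ℕ} (hk : 2 ≤ k) :
    ∃ γ : ℝ, 1 - 1 / Real.sqrt ((k : ℝ) + 3) < γ ∧ γ ≤ 1 ∧
      γ * ∑ j ∈ Finset.range k, γ ^ j ≤ k * (1 - γ) := by
  set e : ℝ := 1 / Real.sqrt ((k : ℝ) + 3) with he
  have hk' : (2 : ℝ) ≤ k := by exact_mod_cast hk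
  have hs : 0 < Real.sqrt ((k : ℝ) + 3) := Real.sqrt_pos.2 (by linarith)
  have he0 : 0 < e := by positivity
  have hesq : e ^ 2 * (k + 3) = 1 := by
    rw [he, div_pow, Real.sq_sqrt (by linarith)]
    field_simp
  have he1 : e < 1 := by nlinarith
  have hstrict : (1 - e) * ∑ j ∈ Finset.range k, (1 - e) ^ j < k * (1 - (1 - e)) := by
    have hgeom := geom_sum_mul_neg (1 - e) k
    have hmain : (1 - e) * (1 - (1 - e) ^ k) < k * e ^ 2 := by
      have h1 : (k : ℝ) * e ^ 2 = 1 - 3 * e ^ 2 := by linarith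
      rw [h1]
      -- For `k ≥ 6`, `e ≤ 1 / 3` gives `1 - e ≤ 1 - 3 * e ^ 2`, and the positive power `(1 - e) ^
      -- k` makes the inequality strict. For smaller `k` this is too crude; there `e ^ 2` is an
      -- explicit rational, and the claim becomes linear in `e`.
      rcases (show k = 2 ∨ k = 3 ∨ k = 4 ∨ k = 5 ∨ 6 ≤ k by omega) with rfl | rfl | rfl | rfl | h6
      · have e2 : e ^ 2 = 1 / 5 := by norm_num at hesq; linarith
        have hlo : 0.44 < e := by nlinarith
        have hhi : e < 0.45 := by nlinarith
        have e3 : e ^ 3 = e / 5 := by rw [pow_succ, e2]; ring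
        have e4 : e ^ 4 = 1 / 5 ^ 2 := by rw [show e ^ 4 = (e ^ 2) ^ 2 by ring, e2]; ring
        have e5 : e ^ 5 = e / 5 ^ 2 := by rw [pow_succ, e4]; ring
        have e6 : e ^ 6 = 1 / 5 ^ 3 := by rw [show e ^ 6 = (e ^ 2) ^ 3 by ring, e2]; ring
        linarith
      · have e2 : e ^ 2 = 1 / 6 := by norm_num at hesq; linarith
        have hlo : 0.4 < e := by nlinarith
        have hhi : e < 0.41 := by nlinarith
        have e3 : e ^ 3 = e / 6 := by rw [pow_succ, e2]; ring
        have e4 : e ^ 4 = 1 / 6 ^ 2 := by rw [show e ^ 4 = (e ^ 2) ^ 2 by ring, e2]; ring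
        have e5 : e ^ 5 = e / 6 ^ 2 := by rw [pow_succ, e4]; ring
        have e6 : e ^ 6 = 1 / 6 ^ 3 := by rw [show e ^ 6 = (e ^ 2) ^ 3 by ring, e2]; ring
        linarith
      · have e2 : e ^ 2 = 1 / 7 := by norm_num at hesq; linarith
        have hlo : 0.37 < e := by nlinarith
        have hhi : e < 0.38 := by nlinarith
        have e3 : e ^ 3 = e / 7 := by rw [pow_succ, e2]; ring
        have e4 : e ^ 4 = 1 / 7 ^ 2 := by rw [show e ^ 4 = (e ^ 2) ^ 2 by ring, e2]; ring
        have e5 : e ^ 5 = e / 7 ^ 2 := by rw [pow_succ, e4]; ring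
        have e6 : e ^ 6 = 1 / 7 ^ 3 := by rw [show e ^ 6 = (e ^ 2) ^ 3 by ring, e2]; ring
        linarith
      · have e2 : e ^ 2 = 1 / 8 := by norm_num at hesq; linarith
        have hlo : 0.35 < e := by nlinarith
        have hhi : e < 0.36 := by nlinarith
        have e3 : e ^ 3 = e / 8 := by rw [pow_succ, e2]; ring
        have e4 : e ^ 4 = 1 / 8 ^ 2 := by rw [show e ^ 4 = (e ^ 2) ^ 2 by ring, e2]; ring
        have e5 : e ^ 5 = e / 8 ^ 2 := by rw [pow_succ, e4]; ring
        have e6 : e ^ 6 = 1 / 8 ^ 3 := by rw [show e ^ 6 = (e ^ 2) ^ 3 by ring, e2]; ring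
        linarith
      · have h6' : (6 : ℝ) ≤ k := by exact_mod_cast h6
        have h2 : 0 < (1 - e) ^ k := pow_pos (by linarith) k
        have h3 : e ≤ 1 / 3 := by
          by_contra hcon
          nlinarith
        nlinarith
    have : (1 - e) * ((∑ j ∈ Finset.range k, (1 - e) ^ j) * (1 - (1 - e))) < k * e * e := by
      rw [hgeom]; linarith
    have h2 : ((1 - e) * ∑ j ∈ Finset.range k, (1 - e) ^ j) * e < k * e * e := by
      calc _ = (1 - e) * ((∑ j ∈ Finset.range k, (1 - e) ^ j) * (1 - (1 - e))) := by ring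
        _ < _ := this
    have := lt_of_mul_lt_mul_right h2 he0.le
    linarith
  have hcont : Continuous fun γ : ℝ => k * (1 - γ) - γ * ∑ j ∈ Finset.range k, γ ^ j := by
    fun_prop
  have hev := (hcont.tendsto (1 - e)).eventually (lt_mem_nhds (sub_pos.2 hstrict))
  have hev1 : ∀ᶠ γ in nhds (1 - e), γ < 1 := gt_mem_nhds (by linarith)
  obtain ⟨γ, ⟨hγ1, hγ2⟩, hγ3⟩ :=
    (((hev.and hev1).filter_mono nhdsWithin_le_nhds).and
      (self_mem_nhdsWithin (s := Set.Ioi (1 - e)))).exists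
  exact ⟨γ, hγ3, hγ2.le, by linarith⟩

/-! ### Expected value under booking limits with independent buyers -/

/-- Independence of one coordinate from a function of the others. -/
lemma lintegral_pi_mul_of_update {n : ℕ} {Z : Type*} [MeasurableSpace Z]
    (μ : Fin n → Measure Z) [∀ i, IsProbabilityMeasure (μ i)] {i : Fin n} {f : Z → ℝ≥0∞}
    (hf : Measurable f) {G : (Fin n → Z) → ℝ≥0∞} (hG : Measurable G)
    (hGi : ∀ z u, G (Function.update z i u) = G z) :
    ∫⁻ z, f (z i) * G z ∂Measure.pi μ = (∫⁻ u, f u ∂μ i) * ∫⁻ z, G z ∂Measure.pi μ := by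
  rw [← lintegral_const_mul _ hG]
  refine lintegral_eq_of_lmarginal_eq {i} ((hf.comp (measurable_pi_apply i)).mul hG)
    (hG.const_mul _) ?_
  rw [lmarginal_singleton, lmarginal_singleton]
  funext z
  simp only [hGi, Function.update_self, lintegral_const, measure_univ, mul_one]
  rw [lintegral_mul_const _ hf]

/-- Number of requests of class `t < T` if class `t` can only be that of buyer `own t`. -/
def ownRequests {n : ℕ} (T : ℕ) (own : ℕ → Fin n) (c : Fin n → ℕ) (t : ℕ) : ℕ :=
  if t < T ∧ c (own t) = t then 1 else 0

lemma valueBelow_nonneg {θ N : ℕ → ℕ} (hθ : Monotone θ) {y : ℕ → ℝ} (hy : ∀ t, 0 ≤ y t) (T : ℕ) :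
    0 ≤ valueBelow θ N y T := by
  refine Finset.sum_nonneg fun q _ => mul_nonneg (hy q) (sub_nonneg.2 ?_)
  have := soldBelow_le_limit hθ N q
  have h : soldBelow θ N q ≤ soldBelow θ N (q + 1) := by simp only [soldBelow]; omega
  exact_mod_cast h

lemma valueBelow_congr {θ N N' : ℕ → ℕ} {T : ℕ} (h : ∀ q < T, N q = N' q) (y : ℕ → ℝ) :
    valueBelow θ N y T = valueBelow θ N' y T := by
  refine Finset.sum_congr rfl fun q hq => ?_
  have hq := Finset.mem_range.1 hq
  rw [soldBelow_congr (p := q + 1) fun r hr => h r (by omega),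
    soldBelow_congr (p := q) fun r hr => h r (by omega)]

/-- The expected value obtained with the booking limits is at least the opportunity cost of all
units at the start. -/
lemma IsCostProcess.le_lintegral_valueBelow {n k T : ℕ} {y : ℕ → ℝ} {d : ℕ → ℕ → ℝ}
    {ν : Fin n → Measure ℕ} [∀ i, IsProbabilityMeasure (ν i)] {own : ℕ → Fin n}
    (h : IsCostProcess k (fun t => (ν (own t)).real {t}) y T d) (hy0 : ∀ t, 0 ≤ y t)
    {θ : ℕ → ℕ} (hθm : Monotone θ) (hθk : ∀ t, θ t ≤ k)
    (hθ : ∀ t < T, ∀ s, s < θ t ↔ s < k ∧ d (t + 1) s ≤ y t) :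
    ENNReal.ofReal (∑ ℓ ∈ Finset.range k, d 0 ℓ) ≤
      ∫⁻ c, ENNReal.ofReal (valueBelow θ (ownRequests T own c) y T) ∂Measure.pi ν := by
  set x : ℕ → ℝ := fun t => (ν (own t)).real {t} with hx
  have hx0 : ∀ t, 0 ≤ x t := fun t => measureReal_nonneg
  have hx1 : ∀ t, x t ≤ 1 := fun t => measureReal_le_one
  set G : ℕ → (Fin n → ℕ) → ℝ≥0∞ := fun t c =>
    ENNReal.ofReal (saleGain k (y t) (d (t + 1)) (soldBelow θ (ownRequests T own c) t)) with hG
  have hmeas : ∀ F : (Fin n → ℕ) → ℝ≥0∞, Measurable F := fun F => Measurable.of_discrete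
  have hpath : ∀ c : Fin n → ℕ, ENNReal.ofReal (valueBelow θ (ownRequests T own c) y T) +
        ∑ t ∈ Finset.range T, ENNReal.ofReal (x t) * G t c =
      ENNReal.ofReal (∑ ℓ ∈ Finset.range k, d 0 ℓ) +
        ∑ t ∈ Finset.range T, (ownRequests T own c t : ℝ≥0∞) * G t c := by
    intro c
    have h1 := h.value_add_sum hθm hθk hθ (N := ownRequests T own c)
      (fun t _ => by unfold ownRequests; split_ifs <;> simp)
    have hg0 : ∀ t, 0 ≤ saleGain k (y t) (d (t + 1)) (soldBelow θ (ownRequests T own c) t) :=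
      fun t => saleGain_nonneg _ _ _ _
    have h2 := congrArg ENNReal.ofReal h1
    rw [ENNReal.ofReal_add (valueBelow_nonneg hθm hy0 T)
        (Finset.sum_nonneg fun t _ => mul_nonneg (hx0 t) (hg0 t)),
      ENNReal.ofReal_add (Finset.sum_nonneg fun ℓ _ => h.nonneg hx0 hx1 (Nat.zero_le T) ℓ)
        (Finset.sum_nonneg fun t _ => mul_nonneg (Nat.cast_nonneg _) (hg0 t)),
      ENNReal.ofReal_sum_of_nonneg fun t _ => mul_nonneg (hx0 t) (hg0 t),
      ENNReal.ofReal_sum_of_nonneg fun t _ => mul_nonneg (Nat.cast_nonneg _) (hg0 t)] at h2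
    simpa only [ENNReal.ofReal_mul (hx0 _), ENNReal.ofReal_mul (Nat.cast_nonneg _),
      ENNReal.ofReal_natCast] using h2
  have hint := lintegral_congr (μ := Measure.pi ν) hpath
  rw [lintegral_add_left (hmeas _), lintegral_add_left (hmeas _),
    lintegral_finsetSum _ fun t _ => hmeas _, lintegral_finsetSum _ fun t _ => hmeas _,
    lintegral_const, measure_univ, mul_one] at hint
  -- If buyer `i` owning class `t` has that class, he made no earlier request, so the units sold
  -- before `t` are the same as with him moved to the unserved class `T`. That count is independent
  -- of `c i`. In general, removing his requests lowers the count, hence raises the gain, which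
  -- gives the inequality.
  have hterm : ∀ t ∈ Finset.range T, ∫⁻ c, ENNReal.ofReal (x t) * G t c ∂Measure.pi ν ≤
      ∫⁻ c, (ownRequests T own c t : ℝ≥0∞) * G t c ∂Measure.pi ν := by
    intro t ht
    have ht := Finset.mem_range.1 ht
    set i := own t with hi
    have hanti := saleGain_antitone (y t) (h.le_succ hx0 hx1 (Nat.succ_le_of_lt ht))
    have h1 : ∀ c, (ownRequests T own c t : ℝ≥0∞) * G t c =
        (Set.indicator {t} (fun _ => 1) (c i)) * G t (Function.update c i T) := by
      intro c
      by_cases hc : c i = t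
      · have hs : soldBelow θ (ownRequests T own c) t =
            soldBelow θ (ownRequests T own (Function.update c i T)) t := by
          refine soldBelow_congr fun q hq => ?_
          unfold ownRequests
          by_cases hqi : own q = i
          · rw [hqi, Function.update_self, if_neg (by omega), if_neg (by omega)]
          · rw [Function.update_of_ne hqi]
        simp only [hG, ← hs]
        simp [ownRequests, ht, hc, ← hi]
      · simp [ownRequests, hc, ← hi]
    have h2 : ∫⁻ u, Set.indicator {t} (fun _ => (1 : ℝ≥0∞)) u ∂ν i = ENNReal.ofReal (x t) := by
      rw [lintegral_indicator (MeasurableSet.singleton t)]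
      simp [hx, ← hi]
    simp only [h1]
    rw [lintegral_pi_mul_of_update ν (f := Set.indicator {t} fun _ => 1)
      Measurable.of_discrete (hmeas fun c => G t (Function.update c i T))
      (fun z u => by rw [Function.update_idem]), h2, ← lintegral_const_mul _ (hmeas _)]
    refine lintegral_mono fun c => mul_le_mul_right (ENNReal.ofReal_le_ofReal (hanti ?_)) _
    refine soldBelow_mono (fun q => ?_) t
    unfold ownRequests
    by_cases hqi : own q = i
    · rw [hqi, Function.update_self, if_neg (by omega)]
      exact Nat.zero_le _
    · rw [Function.update_of_ne hqi]
  -- Finiteness allows this sum to be cancelled from the integrated identity.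
  have hfin : ∑ t ∈ Finset.range T, ∫⁻ c, ENNReal.ofReal (x t) * G t c ∂Measure.pi ν ≠ ∞ := by
    refine (ENNReal.sum_lt_top.2 fun t ht => ?_).ne
    have ht := Finset.mem_range.1 ht
    refine (lintegral_mono (g := fun _ => ENNReal.ofReal (x t) * ENNReal.ofReal (y t))
      fun c => mul_le_mul_right (ENNReal.ofReal_le_ofReal ?_) _).trans_lt ?_
    · unfold saleGain
      split_ifs
      · have := h.nonneg hx0 hx1 (Nat.succ_le_of_lt ht) (soldBelow θ (ownRequests T own c) t)
        exact max_le (sub_le_self _ this) (hy0 t)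
      · exact hy0 t
    · rw [lintegral_const, measure_univ, mul_one]
      exact ENNReal.mul_lt_top ENNReal.ofReal_lt_top ENNReal.ofReal_lt_top
  refine (ENNReal.add_le_add_iff_right hfin).1 ?_
  rw [hint]
  exact add_le_add le_rfl (Finset.sum_le_sum hterm)

/-! ### Booking schemes for one item -/

/-- An online rule for selling one item: each buyer is assigned to a class, and at most `limit p`
units go to the classes up to `p`. Classes from `classes` on are not served. -/
structure BookingScheme (n : ℕ) (Z : Type*) [MeasurableSpace Z] where
  limit : ℕ → ℕ
  classes : ℕ
  cls : Fin n → Z → ℕ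
  measurable_cls : ∀ i, Measurable (cls i)

namespace BookingScheme

variable {n : ℕ} {Z : Type*} [MeasurableSpace Z] (B : BookingScheme n Z)

/-- The class of the buyer in position `s`. -/
def arrival (z : Fin n → Z) (π : Equiv.Perm (Fin n)) (s : ℕ) : ℕ :=
  if h : s < n then B.cls (π ⟨s, h⟩) (z (π ⟨s, h⟩)) else 0

/-- The total value of the buyers that are served. -/
def acceptedValue (X : Fin n → Z → ℝ≥0) (z : Fin n → Z) (π : Equiv.Perm (Fin n)) : ℝ≥0 :=
  ∑ t : Fin n, if Accepts B.limit B.classes (B.arrival z π) t then X (π t) (z (π t)) else 0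

lemma arrival_fin (z : Fin n → Z) (π : Equiv.Perm (Fin n)) (s : Fin n) :
    B.arrival z π s = B.cls (π s) (z (π s)) := by
  simp [arrival]

lemma classCount_arrival (z : Fin n → Z) (π : Equiv.Perm (Fin n)) (p : ℕ) :
    classCount (B.arrival z π) n p = (Finset.univ.filter fun i => B.cls i (z i) = p).card := by
  have h1 : classCount (B.arrival z π) n p =
      (Finset.univ.filter fun s : Fin n => B.arrival z π s = p).card := by
    unfold classCount
    rw [Finset.card_filter, Finset.card_filter, Finset.sum_range]
  rw [h1, Finset.card_filter, Finset.card_filter]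
  simp only [arrival_fin]
  exact Equiv.sum_comp π fun i => if B.cls i (z i) = p then 1 else 0

lemma valueBelow_le_acceptedValue {y : ℕ → ℝ} (hy : Monotone y) {X : Fin n → Z → ℝ≥0}
    (hX : ∀ i u, B.cls i u < B.classes → y (B.cls i u) ≤ X i u) (z : Fin n → Z)
    (π : Equiv.Perm (Fin n)) :
    ENNReal.ofReal (valueBelow B.limit
      (fun p => (Finset.univ.filter fun i => B.cls i (z i) = p).card) y B.classes) ≤
        B.acceptedValue X z π := by
  -- Beyond position `n` the value is set to that of the class, so that the hypothesis holds for all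
  -- `s`; only positions below `n` are summed.
  have h := valueBelow_le_accepted (θ := B.limit) (T := B.classes) (g := B.arrival z π) hy
    (X := fun s => if h : s < n then (X (π ⟨s, h⟩) (z (π ⟨s, h⟩)) : ℝ) else y (B.arrival z π s))
    (fun s hs => by
      unfold arrival at hs ⊢
      split_ifs with hsn
      · rw [dif_pos hsn] at hs; exact hX _ _ hs
      · exact le_rfl) n
  rw [funext (B.classCount_arrival z π), Finset.sum_range] at h
  refine ENNReal.ofReal_le_of_le_toReal (h.trans (le_of_eq ?_))
  rw [ENNReal.coe_toReal, acceptedValue, NNReal.coe_sum]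
  refine Finset.sum_congr rfl fun s _ => ?_
  by_cases hacc : Accepts B.limit B.classes (B.arrival z π) s
  · rw [if_pos hacc, if_pos hacc, dif_pos s.isLt]
  · rw [if_neg hacc, if_neg hacc, NNReal.coe_zero]

end BookingScheme

/-! ### First come, first served: infinite expectation and a single copy -/

section SingleClass

variable {n : ℕ} {Z : Type*} [MeasurableSpace Z]

/-- One unit is sold to the first buyer with `z i ∈ A i`. -/
noncomputable def firstComeScheme (A : Fin n → Set Z) (hA : ∀ i, MeasurableSet (A i)) :
    BookingScheme n Z where
  limit := fun _ => 1
  classes := 1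
  cls := fun i => (A i)ᶜ.indicator fun _ => 1
  measurable_cls := fun i => measurable_const.indicator (hA i).compl

lemma exists_le_acceptedValue_firstCome {A : Fin n → Set Z} (hA : ∀ i, MeasurableSet (A i))
    (X : Fin n → Z → ℝ≥0) (z : Fin n → Z) (π : Equiv.Perm (Fin n)) (h : ∃ i, z i ∈ A i) :
    ∃ i, z i ∈ A i ∧ X i (z i) ≤ (firstComeScheme A hA).acceptedValue X z π := by
  classical
  obtain ⟨i, hi⟩ := h
  obtain ⟨s, hsn, hs0, hacc⟩ := exists_accepted_of_single_class
    (g := (firstComeScheme A hA).arrival z π) (n := n)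
    ⟨π.symm i, (π.symm i).isLt, by
      rw [BookingScheme.arrival_fin]; simp [firstComeScheme, hi]⟩
  have hmem : z (π ⟨s, hsn⟩) ∈ A (π ⟨s, hsn⟩) := by
    have h1 := (firstComeScheme A hA).arrival_fin z π ⟨s, hsn⟩
    simp only [hs0] at h1
    by_contra hcon
    simp [firstComeScheme, hcon] at h1
  refine ⟨π ⟨s, hsn⟩, hmem, ?_⟩
  have h2 := Finset.single_le_sum (f := fun t : Fin n =>
    if Accepts (firstComeScheme A hA).limit (firstComeScheme A hA).classes
      ((firstComeScheme A hA).arrival z π) t then X (π t) (z (π t)) else 0)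
    (fun _ _ => bot_le) (Finset.mem_univ ⟨s, hsn⟩)
  refine le_trans (le_of_eq ?_) h2
  exact (if_pos hacc).symm

end SingleClass

/-- `B` sells at most `k` units of an item and, in expectation over independent buyers, obtains at
least the fraction `γ` of their total value, whatever the order of arrival. -/
def BookingScheme.Guarantees {n : ℕ} {Z : Type*} [MeasurableSpace Z] (B : BookingScheme n Z)
    (μ : Fin n → Measure Z) (X : Fin n → Z → ℝ≥0) (k : ℕ) (γ : ℝ≥0∞) : Prop :=
  (∀ p, B.limit p ≤ k) ∧ ∃ L : (Fin n → Z) → ℝ≥0∞, Measurable L ∧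
    (∀ z π, L z ≤ B.acceptedValue X z π) ∧
    γ * ∑ i, ∫⁻ u, X i u ∂μ i ≤ ∫⁻ z, L z ∂Measure.pi μ

section Guarantees

variable {n : ℕ} {Z : Type*} [MeasurableSpace Z] {μ : Fin n → Measure Z}
  [∀ i, IsProbabilityMeasure (μ i)] {X : Fin n → Z → ℝ≥0}

/-- Reserving a unit for the one buyer with infinite expected value already yields infinite welfare.
-/
lemma exists_guarantees_of_lintegral_eq_top (hX : ∀ i, Measurable (X i)) {k : ℕ} (hk : 0 < k)
    {i : Fin n} (hi : ∫⁻ u, X i u ∂μ i = ∞) (γ : ℝ≥0∞) :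
    ∃ B : BookingScheme n Z, B.Guarantees μ X k γ := by
  classical
  have hA : ∀ j, MeasurableSet {_u : Z | j = i} := fun j => MeasurableSet.const _
  refine ⟨firstComeScheme (fun j => {_u | j = i}) hA, fun _ => hk, fun z => X i (z i),
    ((hX i).comp (measurable_pi_apply i)).coe_nnreal_ennreal, fun z π => ?_, ?_⟩
  · obtain ⟨j, hj, hle⟩ := exists_le_acceptedValue_firstCome hA X z π ⟨i, rfl⟩
    obtain rfl : j = i := hj
    exact ENNReal.coe_le_coe.2 hle
  · have h := lintegral_pi_mul_of_update μ (i := i) (hX i).coe_nnreal_ennreal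
      (G := fun _ => 1) measurable_const (fun _ _ => rfl)
    simp only [mul_one, lintegral_const, measure_univ] at h
    rw [h, hi]
    exact le_top

/-- The threshold prophet inequality against the ex-ante value `E`, with `p = E / 2`. Since the
probabilities of nonzero values add up to at most one, the excesses over `p` have total expectation
at least `E - p = p`. A sale brings `p`, and buyer `i` adds his excess at least when nobody else
reaches `p`, an event independent of him that contains `Q`, the event of no sale. So the expectation
is at least `p * P(Qᶜ) + p * P(Q) = p`. -/
lemma exists_guarantees_half (hX : ∀ i, Measurable (X i)) (h0 : ∑ i, μ i {u | X i u ≠ 0} ≤ 1)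
    (hfin : ∑ i, ∫⁻ u, X i u ∂μ i ≠ ∞) :
    ∃ B : BookingScheme n Z, B.Guarantees μ X 1 2⁻¹ := by
  classical
  set E : ℝ≥0 := (∑ i, ∫⁻ u, X i u ∂μ i).toNNReal with hE
  have hEc : ∑ i, ∫⁻ u, X i u ∂μ i = E := (ENNReal.coe_toNNReal hfin).symm
  set p : ℝ≥0 := E / 2 with hp
  have hpE : p + p = E := by rw [hp]; exact add_halves E
  have hA : ∀ i, MeasurableSet {u | p ≤ X i u} := fun i => measurableSet_le measurable_const (hX i)
  let S : Fin n → Set (Fin n → Z) := fun i => {z | ∀ j, j ≠ i → X j (z j) < p}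
  let Q : Set (Fin n → Z) := {z | ∀ j, X j (z j) < p}
  have hmj : ∀ j, MeasurableSet {z : Fin n → Z | X j (z j) < p} := fun j =>
    measurableSet_lt ((hX j).comp (measurable_pi_apply j)) measurable_const
  have hS : ∀ i, MeasurableSet (S i) := fun i => by
    have : S i = ⋂ j, ⋂ (_ : j ≠ i), {z : Fin n → Z | X j (z j) < p} := by ext; simp [S]
    rw [this]
    exact MeasurableSet.iInter fun j => MeasurableSet.iInter fun _ => hmj j
  have hQ : MeasurableSet Q := by
    have : Q = ⋂ j, {z : Fin n → Z | X j (z j) < p} := by ext; simp [Q]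
    rw [this]
    exact MeasurableSet.iInter hmj
  have hQS : ∀ i, Q ⊆ S i := fun i z hz j _ => hz j
  let f : Fin n → Z → ℝ≥0∞ := fun i u => ((X i u - p : ℝ≥0) : ℝ≥0∞)
  have hf : ∀ i, Measurable (f i) := fun i => ((hX i).sub_const p).coe_nnreal_ennreal
  have hf' : ∀ i, Measurable fun z : Fin n → Z => f i (z i) := fun i =>
    (hf i).comp (measurable_pi_apply i)
  have h1S : ∀ i, Measurable ((S i).indicator fun _ => (1 : ℝ≥0∞)) := fun i =>
    measurable_const.indicator (hS i)
  have hfS : ∀ i, Measurable fun z : Fin n → Z =>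
      f i (z i) * (S i).indicator (fun _ => 1) z := fun i => (hf' i).mul (h1S i)
  refine ⟨firstComeScheme (fun i => {u | p ≤ X i u}) hA, fun _ => le_rfl, fun z =>
    (Qᶜ.indicator (fun _ => (p : ℝ≥0∞)) z + ∑ i, f i (z i) * (S i).indicator (fun _ => 1) z),
    (measurable_const.indicator hQ.compl).add
      (Finset.measurable_fun_sum _ fun i _ => hfS i), fun z π => ?_, ?_⟩
  · by_cases hz : z ∈ Q
    · have : ∀ i, f i (z i) = 0 := fun i => by
        simp only [f, ENNReal.coe_eq_zero]; exact tsub_eq_zero_of_le (hz i).le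
      simp [hz, this]
    · obtain ⟨j, hj⟩ : ∃ j, p ≤ X j (z j) := by simpa [Q] using hz
      obtain ⟨i, hi, hle⟩ := exists_le_acceptedValue_firstCome hA X z π ⟨j, hj⟩
      have hi : p ≤ X i (z i) := hi
      have h2 : ∀ l, l ≠ i → (S l).indicator (fun _ => (1 : ℝ≥0∞)) z = 0 := fun l hl =>
        Set.indicator_of_notMem (fun hcon : ∀ j, j ≠ l → X j (z j) < p =>
          absurd (hcon i hl.symm) (not_lt.2 hi)) _
      change Qᶜ.indicator (fun _ => (p : ℝ≥0∞)) z +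
        ∑ i, f i (z i) * (S i).indicator (fun _ => 1) z ≤ _
      rw [Set.indicator_of_mem (show z ∈ Qᶜ from hz),
        Finset.sum_eq_single i (fun l _ hl => by rw [h2 l hl, mul_zero]) (by simp)]
      have h3 : (S i).indicator (fun _ => (1 : ℝ≥0∞)) z ≤ 1 := Set.indicator_le_self' (by simp) z
      calc (p : ℝ≥0∞) + f i (z i) * (S i).indicator (fun _ => 1) z
          ≤ p + f i (z i) * 1 := by gcongr
        _ = X i (z i) := by
          rw [mul_one]; simp only [f]; rw [← ENNReal.coe_add, add_tsub_cancel_of_le hi]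
        _ ≤ _ := ENNReal.coe_le_coe.2 hle
  · rw [lintegral_add_left (measurable_const.indicator hQ.compl), lintegral_finsetSum _
      fun i _ => hfS i, lintegral_indicator hQ.compl, setLIntegral_const]
    have h2 : ∀ i, (∫⁻ u, f i u ∂μ i) * Measure.pi μ Q ≤
        ∫⁻ z, f i (z i) * (S i).indicator (fun _ => 1) z ∂Measure.pi μ := fun i => by
      rw [lintegral_pi_mul_of_update μ (hf i) (h1S i) fun z u => ?_, lintegral_indicator (hS i),
        setLIntegral_const, one_mul]
      · gcongr
        exact hQS i
      · have : Function.update z i u ∈ S i ↔ z ∈ S i :=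
          forall₂_congr fun j hj => by rw [Function.update_of_ne hj]
        simp [Set.indicator, this]
    have h3 : ∀ i, ∫⁻ u, X i u ∂μ i ≤ ∫⁻ u, f i u ∂μ i + p * μ i {u | X i u ≠ 0} := fun i => by
      have hm : MeasurableSet {u | X i u ≠ 0} := (hX i) (measurableSet_singleton 0).compl
      rw [← setLIntegral_const, ← lintegral_indicator hm, ← lintegral_add_left (hf i)]
      refine lintegral_mono fun u => ?_
      by_cases hu : X i u = 0
      · simp [hu]
      · rw [Set.indicator_of_mem (show u ∈ {u | X i u ≠ 0} from hu)]
        simp only [f]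
        exact_mod_cast le_tsub_add
    have h4 : (p : ℝ≥0∞) ≤ ∑ i, ∫⁻ u, f i u ∂μ i := by
      have h5 : (E : ℝ≥0∞) ≤ ∑ i, ∫⁻ u, f i u ∂μ i + p := by
        rw [← hEc]
        refine (Finset.sum_le_sum fun i _ => h3 i).trans ?_
        rw [Finset.sum_add_distrib, ← Finset.mul_sum]
        gcongr
        exact (mul_le_mul_right h0 _).trans (mul_one _).le
      rw [← hpE, ENNReal.coe_add] at h5
      exact (ENNReal.add_le_add_iff_right ENNReal.coe_ne_top).1 h5
    have h6 : Measure.pi μ Qᶜ + Measure.pi μ Q = 1 := by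
      rw [add_comm, measure_add_measure_compl hQ, measure_univ]
    calc 2⁻¹ * ∑ i, ∫⁻ u, X i u ∂μ i = p := by
          rw [hEc, hp, ENNReal.coe_div two_ne_zero, mul_comm, ENNReal.div_eq_inv_mul]
          rw [mul_comm]; rfl
      _ = p * Measure.pi μ Qᶜ + p * Measure.pi μ Q := by rw [← mul_add, h6, mul_one]
      _ ≤ p * Measure.pi μ Qᶜ + (∑ i, ∫⁻ u, f i u ∂μ i) * Measure.pi μ Q := by gcongr
      _ ≤ _ := by
        rw [Finset.sum_mul]
        gcongr
        exact h2 _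

end Guarantees

/-! ### Rounding to finitely many classes, and the single-item guarantee -/

/-- Index of the largest multiple of `1 / N` that is at most `a`, cut off at `N ^ 2`. -/
noncomputable def gridLevel (N : ℕ) (a : ℝ≥0) : ℕ := min ⌊(N : ℝ≥0) * a⌋₊ (N ^ 2)

lemma measurable_gridLevel (N : ℕ) : Measurable (gridLevel N) :=
  (Nat.measurable_floor.comp (measurable_const_mul (N : ℝ≥0))).min measurable_const

lemma gridLevel_zero (N : ℕ) : gridLevel N 0 = 0 := by simp [gridLevel]

lemma gridLevel_div_le (N : ℕ) (a : ℝ≥0) : (gridLevel N a : ℝ≥0) / N ≤ a := by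
  rcases Nat.eq_zero_or_pos N with rfl | hN
  · simp
  have hN' : (0 : ℝ≥0) < N := by exact_mod_cast hN
  rw [div_le_iff₀ hN', mul_comm]
  exact (Nat.cast_le.2 (min_le_left _ _)).trans (Nat.floor_le bot_le)

lemma tendsto_gridLevel_div (a : ℝ≥0) :
    Filter.Tendsto (fun N : ℕ => (gridLevel N a : ℝ≥0) / N) Filter.atTop (nhds a) := by
  have h1 := tendsto_nat_floor_mul_div_atTop (R := ℝ) (a := a) a.2
  have h2 := h1.comp tendsto_natCast_atTop_atTop (α := ℕ)
  rw [← NNReal.tendsto_coe]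
  refine h2.congr' ?_
  obtain ⟨M, hM⟩ := exists_nat_ge a
  filter_upwards [Filter.eventually_ge_atTop M] with N hN
  have h3 : ⌊(N : ℝ≥0) * a⌋₊ ≤ N ^ 2 := by
    refine Nat.floor_le_of_le ?_
    push_cast
    rw [sq]
    gcongr
    exact hM.trans (by exact_mod_cast hN)
  have h4 : ⌊(a : ℝ) * (N : ℝ)⌋₊ = ⌊(N : ℝ≥0) * a⌋₊ := by
    rw [mul_comm, Nat.floor_eq_iff (by positivity)]
    have h5 := Nat.floor_le (show 0 ≤ (N : ℝ≥0) * a from bot_le)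
    have h6 := Nat.lt_floor_add_one ((N : ℝ≥0) * a)
    exact ⟨by exact_mod_cast h5, by exact_mod_cast h6⟩
  simp only [Function.comp_apply, gridLevel, min_eq_left h3, h4]
  push_cast
  rfl

section Grid

variable {n : ℕ} {Z : Type*} [MeasurableSpace Z] {μ : Fin n → Measure Z}
  [∀ i, IsProbabilityMeasure (μ i)] {X : Fin n → Z → ℝ≥0}

/-- The class of a buyer with value `a`: classes are ordered by grid level and, within a level, by
buyer. Level `0` is not served. -/
noncomputable def gridClass (n N : ℕ) (i : Fin n) (a : ℝ≥0) : ℕ :=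
  if gridLevel N a = 0 then N ^ 2 * n else (gridLevel N a - 1) * n + i

lemma gridClass_lt_iff {N : ℕ} {i : Fin n} {a : ℝ≥0} :
    gridClass n N i a < N ^ 2 * n ↔ gridLevel N a ≠ 0 := by
  unfold gridClass
  split_ifs with h
  · simp [h]
  · refine iff_of_true ?_ h
    have h1 : gridLevel N a ≤ N ^ 2 := min_le_right _ _
    obtain ⟨l, hl⟩ := Nat.exists_eq_succ_of_ne_zero h
    rw [hl] at h1 ⊢
    simp only [Nat.succ_eq_add_one, Nat.add_sub_cancel]
    calc l * n + i < l * n + n := by have := i.isLt; omega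
      _ = (l + 1) * n := by ring
      _ ≤ N ^ 2 * n := Nat.mul_le_mul_right n h1

lemma gridClass_mod {N : ℕ} {i : Fin n} {a : ℝ≥0} (h : gridLevel N a ≠ 0) :
    gridClass n N i a % n = i := by
  rw [gridClass, if_neg h, mul_comm, Nat.mul_add_mod, Nat.mod_eq_of_lt i.isLt]

lemma gridClass_div {N : ℕ} {i : Fin n} {a : ℝ≥0} (h : gridLevel N a ≠ 0) :
    gridClass n N i a / n + 1 = gridLevel N a := by
  have hn : 0 < n := i.pos
  rw [gridClass, if_neg h, mul_comm, Nat.mul_add_div hn, Nat.div_eq_of_lt i.isLt]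
  omega

/-- Breaking ties by buyer gives every class a single possible owner, recovered as the residue
modulo `n`, so at most one request has each class. A zero value has level `0` and is not served,
hence the class probabilities still add up to at most `k`. -/
lemma exists_guarantees_grid (hX : ∀ i, Measurable (X i)) {k : ℕ} (hk : 0 < k)
    (h0 : ∑ i, μ i {u | X i u ≠ 0} ≤ k) {γ : ℝ} (hγ0 : 0 < γ) (hγ1 : γ ≤ 1)
    (hγ : γ * ∑ j ∈ Finset.range k, γ ^ j ≤ k * (1 - γ)) (hn : 0 < n) (N : ℕ) :
    ∃ B : BookingScheme n Z, (∀ p, B.limit p ≤ k) ∧ ∃ L : (Fin n → Z) → ℝ≥0∞, Measurable L ∧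
      (∀ z π, L z ≤ B.acceptedValue X z π) ∧
      ENNReal.ofReal γ * ∑ i, ∫⁻ u, ((gridLevel N (X i u) : ℝ≥0) / N : ℝ≥0) ∂μ i ≤
        ∫⁻ z, L z ∂Measure.pi μ := by
  classical
  let T : ℕ := N ^ 2 * n
  let own : ℕ → Fin n := fun p => ⟨p % n, Nat.mod_lt p hn⟩
  let c : Fin n → Z → ℕ := fun i u => gridClass n N i (X i u)
  let y : ℕ → ℝ≥0 := fun p => ((p / n + 1 : ℕ) : ℝ≥0) / N
  have hc : ∀ i, Measurable (c i) := fun i => by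
    have h1 := (measurable_gridLevel N).comp (hX i)
    have h2 : c i = (fun l => if l = 0 then N ^ 2 * n else (l - 1) * n + i) ∘
      (gridLevel N ∘ X i) := rfl
    rw [h2]
    exact Measurable.of_discrete.comp h1
  have hlt : ∀ i u, c i u < T ↔ gridLevel N (X i u) ≠ 0 := fun i u => gridClass_lt_iff
  have hown : ∀ i u, c i u < T → own (c i u) = i := fun i u h =>
    Fin.ext (gridClass_mod ((hlt i u).1 h))
  have hyc : ∀ i u, c i u < T → y (c i u) = (gridLevel N (X i u) : ℝ≥0) / N := fun i u h => by
    simp only [y, c]; rw [gridClass_div ((hlt i u).1 h)]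
  have hym : Monotone fun p => (y p : ℝ) := fun p q hpq => by
    have : y p ≤ y q := by
      simp only [y]
      gcongr
    exact_mod_cast this
  have hy0 : ∀ p, (0 : ℝ) ≤ y p := fun p => (y p).2
  let ν : Fin n → Measure ℕ := fun i => (μ i).map (c i)
  have : ∀ i, IsProbabilityMeasure (ν i) := fun i =>
    Measure.isProbabilityMeasure_map (hc i).aemeasurable
  have hν : ∀ i p, ν i {p} = μ i (c i ⁻¹' {p}) := fun i p =>
    Measure.map_apply (hc i) (MeasurableSet.singleton p)
  have hνown : ∀ p < T, ν (own p) {p} = ∑ i, μ i (c i ⁻¹' {p}) := fun p hp => by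
    rw [Finset.sum_eq_single (own p) (fun i _ hi => ?_) (by simp), hν]
    have : c i ⁻¹' {p} = ∅ := by
      ext u
      simp only [Set.mem_preimage, Set.mem_singleton_iff, Set.mem_empty_iff_false, iff_false]
      rintro rfl
      exact hi (hown i u hp).symm
    rw [this, measure_empty]
  let x : ℕ → ℝ := fun t => (ν (own t)).real {t}
  have hx0 : ∀ t, 0 ≤ x t := fun t => measureReal_nonneg
  have hx1 : ∀ t, x t ≤ 1 := fun t => measureReal_le_one
  have hxof : ∀ t, ENNReal.ofReal (x t) = ν (own t) {t} := fun t =>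
    ENNReal.ofReal_toReal (measure_ne_top _ _)
  have hxk : ∑ t ∈ Finset.range T, x t ≤ k := by
    have h1 : ∑ t ∈ Finset.range T, ν (own t) {t} ≤ k := by
      rw [Finset.sum_congr rfl fun t ht => hνown t (Finset.mem_range.1 ht), Finset.sum_comm]
      refine (Finset.sum_le_sum fun i _ => ?_).trans h0
      rw [← measure_biUnion_finset (fun a _ b _ hab => ?_) fun t _ => hc i (measurableSet_singleton t)]
      · refine measure_mono fun u hu => ?_
        simp only [Set.mem_iUnion, Set.mem_preimage, Set.mem_singleton_iff, Finset.mem_range] at hu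
        obtain ⟨t, ht, hut⟩ := hu
        have := (hlt i u).1 (hut ▸ ht)
        intro hXu
        exact this (by rw [hXu, gridLevel_zero])
      · exact Disjoint.preimage _ (by simpa using hab)
    have h2 : ENNReal.ofReal (∑ t ∈ Finset.range T, x t) ≤ ENNReal.ofReal k := by
      rw [ENNReal.ofReal_sum_of_nonneg fun t _ => hx0 t, ENNReal.ofReal_natCast]
      simpa only [hxof] using h1
    exact (ENNReal.ofReal_le_ofReal_iff (Nat.cast_nonneg k)).1 h2
  obtain ⟨d, hd⟩ := exists_isCostProcess k x (fun p => (y p : ℝ)) T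
  obtain ⟨θ, hθm, hθk, hθ⟩ := hd.exists_limits hx0 hx1 hym
  have hlow := hd.sum_ge hx0 hx1 hxk hk hγ0 hγ1 hγ
  have hexp := hd.le_lintegral_valueBelow (ν := ν) (own := own) hy0 hθm hθk hθ
  let L : (Fin n → Z) → ℝ≥0∞ := fun z => ENNReal.ofReal
    (valueBelow θ (ownRequests T own fun i => c i (z i)) (fun p => (y p : ℝ)) T)
  have hcz : Measurable fun (z : Fin n → Z) i => c i (z i) :=
    measurable_pi_lambda _ fun i => (hc i).comp (measurable_pi_apply i)
  have hval : Measurable fun c : Fin n → ℕ => ENNReal.ofReal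
    (valueBelow θ (ownRequests T own c) (fun p => (y p : ℝ)) T) := Measurable.of_discrete
  refine ⟨⟨θ, T, c, hc⟩, hθk, L, hval.comp hcz, fun z π => ?_, ?_⟩
  · refine le_trans (le_of_eq ?_) (BookingScheme.valueBelow_le_acceptedValue _ hym
      (fun i u h => ?_) z π)
    · simp only [L]
      refine congrArg _ (valueBelow_congr (fun q hq => ?_) _)
      unfold ownRequests
      have h1 : ∀ i, c i (z i) = q → own q = i := fun i h => by
        rw [← h]; exact hown i (z i) (h ▸ hq)
      by_cases hq' : c (own q) (z (own q)) = q
      · rw [if_pos ⟨hq, hq'⟩]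
        symm
        rw [Finset.card_eq_one]
        refine ⟨own q, Finset.ext fun i => ?_⟩
        simp only [Finset.mem_filter, Finset.mem_univ, true_and, Finset.mem_singleton]
        exact ⟨fun h => (h1 i h).symm, fun h => h ▸ hq'⟩
      · rw [if_neg fun h => hq' h.2]
        symm
        rw [Finset.card_eq_zero, Finset.filter_eq_empty_iff]
        intro i _ hi
        exact hq' ((h1 i hi).symm ▸ hi)
    · have h1 := hyc i u h
      have h2 := gridLevel_div_le N (X i u)
      rw [← h1] at h2
      exact_mod_cast h2
  · have h1 : ∫⁻ z, L z ∂Measure.pi μ = ∫⁻ c, ENNReal.ofReal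
        (valueBelow θ (ownRequests T own c) (fun p => (y p : ℝ)) T) ∂Measure.pi ν := by
      rw [← Measure.pi_map_pi fun i => (hc i).aemeasurable, lintegral_map hval hcz]
    rw [h1]
    refine le_trans (le_of_eq ?_) ((ENNReal.ofReal_le_ofReal hlow).trans hexp)
    rw [ENNReal.ofReal_mul hγ0.le,
      ENNReal.ofReal_sum_of_nonneg fun t _ => mul_nonneg (hx0 t) (hy0 t)]
    congr 1
    have h2 : ∀ i u, (((gridLevel N (X i u) : ℝ≥0) / N : ℝ≥0) : ℝ≥0∞) =
        ∑ p ∈ Finset.range T, (c i ⁻¹' {p}).indicator (fun _ => (y p : ℝ≥0∞)) u := by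
      intro i u
      have hz : ∀ p, c i u ≠ p → (c i ⁻¹' {p}).indicator (fun _ => (y p : ℝ≥0∞)) u = 0 :=
        fun p hp => Set.indicator_of_notMem (s := c i ⁻¹' {p}) (fun h' => hp h') _
      by_cases h : c i u < T
      · rw [Finset.sum_eq_single (c i u) (fun p _ hp => hz p hp.symm) (by simp [h]),
          Set.indicator_of_mem (by simp), hyc i u h]
      · have : gridLevel N (X i u) = 0 := by
          by_contra hcon
          exact h ((hlt i u).2 hcon)
        rw [Finset.sum_eq_zero fun p hp => hz p fun e => h (e ▸ Finset.mem_range.1 hp)]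
        simp [this]
    have h3 : ∀ i, ∫⁻ u, ((gridLevel N (X i u) : ℝ≥0) / N : ℝ≥0) ∂μ i =
        ∑ p ∈ Finset.range T, y p * μ i (c i ⁻¹' {p}) := by
      intro i
      have hm : ∀ p, MeasurableSet (c i ⁻¹' {p}) := fun p => hc i (measurableSet_singleton p)
      rw [lintegral_congr (h2 i),
        lintegral_finsetSum _ fun p _ => measurable_const.indicator (hm p)]
      refine Finset.sum_congr rfl fun p _ => ?_
      rw [lintegral_indicator (hm p), setLIntegral_const]
    rw [Finset.sum_congr rfl fun i _ => h3 i, Finset.sum_comm]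
    refine Finset.sum_congr rfl fun p hp => ?_
    rw [← Finset.mul_sum, ← hνown p (Finset.mem_range.1 hp), ENNReal.ofReal_mul (hx0 p), hxof,
      mul_comm, ENNReal.ofReal_coe_nnreal]

/-- Some booking scheme obtains the fraction `1 - 1 / √(k + 3)` of the ex-ante value of an item
with `k` copies. -/
theorem exists_guarantees (hX : ∀ i, Measurable (X i)) {k : ℕ} (hk : 0 < k)
    (h0 : ∑ i, μ i {u | X i u ≠ 0} ≤ k) :
    ∃ B : BookingScheme n Z,
      B.Guarantees μ X k (ENNReal.ofReal (1 - 1 / Real.sqrt ((k : ℝ) + 3))) := by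
  set γ : ℝ := 1 - 1 / Real.sqrt ((k : ℝ) + 3) with hγ
  by_cases hfin : ∑ i, ∫⁻ u, X i u ∂μ i = ∞
  · obtain ⟨i, -, hi⟩ := ENNReal.sum_eq_top.1 hfin
    exact exists_guarantees_of_lintegral_eq_top hX hk hi _
  rcases (show k = 1 ∨ 2 ≤ k by omega) with rfl | hk2
  · obtain ⟨B, hB⟩ := exists_guarantees_half hX (by simpa using h0) hfin
    have h1 : ENNReal.ofReal γ = 2⁻¹ := by
      have : Real.sqrt ((1 : ℕ) + 3) = 2 := by
        rw [show ((1 : ℕ) : ℝ) + 3 = 2 ^ 2 by norm_num]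
        exact Real.sqrt_sq (by norm_num)
      rw [hγ, this, show (1 : ℝ) - 1 / 2 = 2⁻¹ by norm_num,
        ENNReal.ofReal_inv_of_pos (by norm_num)]
      simp
    rw [h1]
    exact ⟨B, hB⟩
  -- The rounded ex-ante values converge to the true ones by dominated convergence, so with `γ'` in
  -- place of `γ` a fine enough grid loses nothing.
  obtain ⟨γ', hlt, hle1, hcond⟩ := exists_gt_magician hk2
  rw [← hγ] at hlt
  have hγ0 : 0 < γ := by
    have : 1 < Real.sqrt ((k : ℝ) + 3) := by
      rw [Real.lt_sqrt (by norm_num)]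
      have : (0 : ℝ) ≤ k := Nat.cast_nonneg k
      linarith
    rw [hγ, sub_pos, div_lt_one (by linarith)]
    exact this
  by_cases hE : ∑ i, ∫⁻ u, X i u ∂μ i = 0
  · refine ⟨⟨fun _ => 0, 0, fun _ _ => 0, fun _ => measurable_const⟩, fun _ => Nat.zero_le _,
      fun _ => 0, measurable_const, fun _ _ => bot_le, ?_⟩
    rw [hE, mul_zero]
    exact bot_le
  have hn : 0 < n := by
    rcases Nat.eq_zero_or_pos n with rfl | hn
    · simp at hE
    · exact hn
  have hlim : Filter.Tendsto (fun N : ℕ =>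
      ∑ i, ∫⁻ u, ((gridLevel N (X i u) : ℝ≥0) / N : ℝ≥0) ∂μ i) Filter.atTop
      (nhds (∑ i, ∫⁻ u, X i u ∂μ i)) := by
    refine tendsto_finsetSum _ fun i _ => ?_
    refine tendsto_lintegral_of_dominated_convergence (fun u => (X i u : ℝ≥0∞)) (fun N => ?_)
      (fun N => Filter.Eventually.of_forall fun u => ?_) (fun h => hfin ?_)
      (Filter.Eventually.of_forall fun u => ?_)
    · have h1 : Measurable fun u => (gridLevel N (X i u) : ℝ≥0) :=
        (Measurable.of_discrete (f := fun l : ℕ => (l : ℝ≥0))).comp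
          ((measurable_gridLevel N).comp (hX i))
      exact (h1.div_const _).coe_nnreal_ennreal
    · exact ENNReal.coe_le_coe.2 (gridLevel_div_le N _)
    · exact ENNReal.sum_eq_top.2 ⟨i, Finset.mem_univ i, h⟩
    · exact ENNReal.tendsto_coe.2 (tendsto_gridLevel_div _)
  have hprod : ENNReal.ofReal γ * ∑ i, ∫⁻ u, X i u ∂μ i <
      ENNReal.ofReal γ' * ∑ i, ∫⁻ u, X i u ∂μ i :=
    (ENNReal.mul_lt_mul_iff_left hE hfin).2
      ((ENNReal.ofReal_lt_ofReal_iff (hγ0.trans hlt)).2 hlt)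
  obtain ⟨N, hN⟩ := ((ENNReal.Tendsto.const_mul hlim
    (Or.inr ENNReal.ofReal_ne_top)).eventually (lt_mem_nhds hprod)).exists
  obtain ⟨B, hBk, L, hLm, hL, hLe⟩ :=
    exists_guarantees_grid hX hk h0 (hγ0.trans hlt) hle1 hcond hn N
  exact ⟨B, hBk, L, hLm, hL, hN.le.trans hLe⟩

end Grid

/-! ### Measurable choice of supporting additive functions -/

section Selection

variable {V E : Type*} [TopologicalSpace V] [NormedAddCommGroup E] [ProperSpace E]

/-- Closed balls are compact in a proper space, and projection along a compact factor is a closed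
map. -/
lemma isClosed_exists_norm_le {C : Set (V × E)} (hC : IsClosed C) (r : ℝ) :
    IsClosed {v | ∃ a, (v, a) ∈ C ∧ ‖a‖ ≤ r} := by
  have : CompactSpace (Metric.closedBall (0 : E) r) :=
    isCompact_iff_compactSpace.1 (isCompact_closedBall 0 r)
  have h1 : IsClosed {p : V × Metric.closedBall (0 : E) r | (p.1, (p.2 : E)) ∈ C} :=
    hC.preimage (by fun_prop)
  convert isClosedMap_fst_of_compactSpace _ h1 using 1
  ext v
  constructor
  · rintro ⟨a, ha, hr⟩
    exact ⟨(v, ⟨a, by simpa using hr⟩), ha, rfl⟩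
  · rintro ⟨⟨w, a, ha⟩, hw, rfl⟩
    exact ⟨a, hw, by simpa using ha⟩

lemma measurableSet_fiber_nonempty [MeasurableSpace V] [OpensMeasurableSpace V]
    {C : Set (V × E)} (hC : IsClosed C) :
    MeasurableSet {v | ∃ a, (v, a) ∈ C} := by
  have : {v | ∃ a, (v, a) ∈ C} = ⋃ N : ℕ, {v | ∃ a, (v, a) ∈ C ∧ ‖a‖ ≤ N} := by
    ext v
    simp only [Set.mem_ofPred_eq, Set.mem_iUnion]
    refine ⟨fun ⟨a, ha⟩ => ?_, fun ⟨_, a, ha, _⟩ => ⟨a, ha⟩⟩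
    obtain ⟨N, hN⟩ := exists_nat_ge ‖a‖
    exact ⟨N, a, ha, hN⟩
  rw [this]
  exact MeasurableSet.iUnion fun N => (isClosed_exists_norm_le hC N).measurableSet

lemma exists_norm_eq_infDist_fiber {C : Set (V × E)} (hC : IsClosed C) {v : V}
    (hv : ∃ a, (v, a) ∈ C) : ∃ a, (v, a) ∈ C ∧ ‖a‖ = Metric.infDist 0 {a | (v, a) ∈ C} := by
  have hcl : IsClosed {a | (v, a) ∈ C} := hC.preimage (by fun_prop)
  obtain ⟨a, ha, hd⟩ := hcl.exists_infDist_eq_dist hv 0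
  exact ⟨a, ha, by rw [hd, dist_zero_left]⟩

lemma measurable_infDist_fiber [MeasurableSpace V] [OpensMeasurableSpace V]
    {C : Set (V × E)} (hC : IsClosed C) :
    Measurable fun v => Metric.infDist 0 {a | (v, a) ∈ C} := by
  refine measurable_of_Iic fun r => ?_
  -- The second set accounts for empty fibers, where `Metric.infDist` has the default value `0`.
  have : (fun v => Metric.infDist 0 {a | (v, a) ∈ C}) ⁻¹' Set.Iic r =
      {v | ∃ a, (v, a) ∈ C ∧ ‖a‖ ≤ r} ∪ ({v | ∃ a, (v, a) ∈ C}ᶜ ∩ {_v | 0 ≤ r}) := by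
    ext v
    simp only [Set.mem_preimage, Set.mem_Iic, Set.mem_union, Set.mem_ofPred_eq, Set.mem_inter_iff,
      Set.mem_compl_iff]
    by_cases hv : ∃ a, (v, a) ∈ C
    · constructor
      · intro h
        obtain ⟨a, ha, hd⟩ := exists_norm_eq_infDist_fiber hC hv
        exact Or.inl ⟨a, ha, hd.trans_le h⟩
      · rintro (⟨a, ha, hr⟩ | h)
        · refine (Metric.infDist_le_dist_of_mem (show a ∈ {a | (v, a) ∈ C} from ha)).trans ?_
          rwa [dist_zero_left]
        · exact absurd hv h.1
    · have he : {a | (v, a) ∈ C} = ∅ := by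
        ext a
        simp only [Set.mem_ofPred_eq, Set.mem_empty_iff_false, iff_false]
        exact fun h => hv ⟨a, h⟩
      rw [he, Metric.infDist_empty]
      constructor
      · exact fun h => Or.inr ⟨hv, h⟩
      · rintro (⟨a, ha, _⟩ | h)
        · exact absurd ⟨a, ha⟩ hv
        · exact h.2
  rw [this]
  exact (isClosed_exists_norm_le hC r).measurableSet.union
    ((measurableSet_fiber_nonempty hC).compl.inter (MeasurableSet.const _))

/-- A closed relation with convex fibers has a measurable selection: the point of least norm. -/
theorem exists_measurable_selection [MeasurableSpace V] [OpensMeasurableSpace V]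
    [NormedSpace ℝ E] [StrictConvexSpace ℝ E] [MeasurableSpace E]
    [BorelSpace E] {C : Set (V × E)} (hC : IsClosed C) (hconv : ∀ v, Convex ℝ {a | (v, a) ∈ C}) :
    ∃ s : V → E, Measurable s ∧ (∀ v, (∃ a, (v, a) ∈ C) → (v, s v) ∈ C) ∧
      ∀ v, (¬ ∃ a, (v, a) ∈ C) → s v = 0 := by
  classical
  let ρ : Set (V × E) → V → ℝ := fun C v => Metric.infDist 0 {a | (v, a) ∈ C}
  have hmin : ∀ v, ∃ b : E, ((∃ a, (v, a) ∈ C) → (v, b) ∈ C ∧ ‖b‖ = ρ C v) ∧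
      ((¬ ∃ a, (v, a) ∈ C) → b = 0) := fun v => by
    by_cases hv : ∃ a, (v, a) ∈ C
    · obtain ⟨b, hb⟩ := exists_norm_eq_infDist_fiber hC hv
      exact ⟨b, fun _ => hb, fun h => absurd hv h⟩
    · exact ⟨0, fun h => absurd h hv, fun _ => rfl⟩
  choose s hs hs0 using hmin
  have huniq : ∀ v b, (v, b) ∈ C → ‖b‖ ≤ ρ C v → b = s v := fun v b hb hle => by
    obtain ⟨h1, h2⟩ := hs v ⟨b, hb⟩
    by_contra hne
    have h3 := norm_combo_lt_of_ne hle h2.le hne (a := 1 / 2) (b := 1 / 2) (by norm_num)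
      (by norm_num) (by norm_num)
    have h4 := hconv v hb h1 (a := 1 / 2) (b := 1 / 2) (by norm_num) (by norm_num) (by norm_num)
    have h5 := Metric.infDist_le_dist_of_mem (x := 0) h4
    rw [dist_zero_left] at h5
    exact absurd (h5.trans_lt h3) (lt_irrefl _)
  refine ⟨s, measurable_of_isClosed fun D hD => ?_, fun v hv => (hs v hv).1, hs0⟩
  have hCD : IsClosed (C ∩ Prod.snd ⁻¹' D) := hC.inter (hD.preimage continuous_snd)
  -- By uniqueness of the least-norm point, it lies in `D` exactly if restricting the fiber to `D`
  -- does not increase the least norm. Empty fibers, where `s` is `0`, are added separately.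
  have hset : s ⁻¹' D = ({v | ∃ a, (v, a) ∈ C ∩ Prod.snd ⁻¹' D} ∩
      {v | ρ (C ∩ Prod.snd ⁻¹' D) v ≤ ρ C v}) ∪ ({v | ∃ a, (v, a) ∈ C}ᶜ ∩ {_v | (0 : E) ∈ D}) := by
    ext v
    simp only [Set.mem_preimage, Set.mem_union, Set.mem_inter_iff, Set.mem_ofPred_eq,
      Set.mem_compl_iff]
    by_cases hv : ∃ a, (v, a) ∈ C
    · obtain ⟨h1, h2⟩ := hs v hv
      constructor
      · intro hD'
        refine Or.inl ⟨⟨s v, h1, hD'⟩, ?_⟩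
        rw [← h2, ← dist_zero_left]
        exact Metric.infDist_le_dist_of_mem ⟨h1, hD'⟩
      · rintro (⟨hne, hle⟩ | h)
        · obtain ⟨b, hb, hd⟩ := exists_norm_eq_infDist_fiber hCD hne
          rw [← huniq v b hb.1 (hd.trans_le hle)]
          exact hb.2
        · exact absurd hv h.1
    · rw [hs0 v hv]
      constructor
      · exact fun h => Or.inr ⟨hv, h⟩
      · rintro (⟨⟨a, ha, _⟩, _⟩ | h)
        · exact absurd ⟨a, ha⟩ hv
        · exact h.2
  rw [hset]
  exact ((measurableSet_fiber_nonempty hCD).inter (measurableSet_le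
    (measurable_infDist_fiber hCD) (measurable_infDist_fiber hC))).union
    ((measurableSet_fiber_nonempty hC).compl.inter (MeasurableSet.const _))

end Selection

/-- Additive functions below an XOS valuation that support it at a given set can be chosen
measurably. -/
theorem exists_measurable_support (m : ℕ) :
    ∃ a : BuyerValuation m → Finset (Fin m) → Fin m → ℝ≥0,
      (∀ S j, Measurable fun v => a v S j) ∧ (∀ v S T, ∑ j ∈ T, a v S j ≤ v T) ∧
      ∀ v S, IsXOS v → ∑ j ∈ S, a v S j = v S := by
  -- Closed convex conditions that do not mention the family `A`; being XOS only ensures that the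
  -- fiber is nonempty. Elsewhere the selection is `0`, which still lies below `v`.
  let C : Finset (Fin m) → Set (BuyerValuation m × EuclideanSpace ℝ (Fin m)) := fun S =>
    {p | (∀ j, 0 ≤ p.2 j) ∧ (∑ j ∈ S, p.2 j = p.1 S) ∧ ∀ T : Finset (Fin m), ∑ j ∈ T, p.2 j ≤ p.1 T}
  have hC : ∀ S, IsClosed (C S) := fun S => by
    have h : C S = (⋂ j, {p | 0 ≤ p.2 j}) ∩ ({p | ∑ j ∈ S, p.2 j = p.1 S} ∩
        ⋂ T : Finset (Fin m), {p | ∑ j ∈ T, p.2 j ≤ p.1 T}) := by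
      ext p; simp [C]
    rw [h]
    refine (isClosed_iInter fun j => isClosed_le ?_ ?_).inter ((isClosed_eq ?_ ?_).inter
      (isClosed_iInter fun T => isClosed_le ?_ ?_)) <;> fun_prop
  have hconv : ∀ S v, Convex ℝ {a | (v, a) ∈ C S} := fun S v a ha b hb α β hα hβ hαβ => by
    have hsum : ∀ T : Finset (Fin m), ∑ j ∈ T, (α • a + β • b) j =
        α * ∑ j ∈ T, a j + β * ∑ j ∈ T, b j := fun T => by
      simp [Finset.sum_add_distrib, Finset.mul_sum]
    refine ⟨fun j => ?_, ?_, fun T => ?_⟩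
    · have h1 := mul_nonneg hα (ha.1 j)
      have h2 := mul_nonneg hβ (hb.1 j)
      simpa using add_nonneg h1 h2
    · have h1 := ha.2.1
      have h2 := hb.2.1
      simp only at h1 h2 ⊢
      rw [hsum, h1, h2, ← add_mul, hαβ, one_mul]
    · have h1 := mul_le_mul_of_nonneg_left (ha.2.2 T) hα
      have h2 := mul_le_mul_of_nonneg_left (hb.2.2 T) hβ
      simp only at h1 h2 ⊢
      rw [hsum]
      refine (add_le_add h1 h2).trans (le_of_eq ?_)
      rw [← add_mul, hαβ, one_mul]
  choose s hsm hsC hs0 using fun S => exists_measurable_selection (hC S) (hconv S)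
  have hnn : ∀ S v j, 0 ≤ s S v j := fun S v j => by
    by_cases hv : ∃ a, (v, a) ∈ C S
    · exact (hsC S v hv).1 j
    · rw [hs0 S v hv]; simp
  refine ⟨fun v S j => (s S v j).toNNReal, fun S j => ?_, fun v S T => ?_, fun v S hv => ?_⟩
  · exact ((EuclideanSpace.proj (𝕜 := ℝ) j).continuous.measurable.comp (hsm S)).real_toNNReal
  · rw [← NNReal.coe_le_coe, NNReal.coe_sum]
    simp only [Real.coe_toNNReal _ (hnn _ _ _)]
    by_cases hv : ∃ a, (v, a) ∈ C S
    · exact (hsC S v hv).2.2 T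
    · rw [hs0 S v hv]; simp
  · obtain ⟨A, hA⟩ := hv
    obtain ⟨a, haA, haS⟩ := (hA S).1
    have hex : ∃ a, (v, a) ∈ C S := by
      refine ⟨WithLp.toLp 2 fun j => (a j : ℝ), fun j => (a j).2, ?_, fun T => ?_⟩
      · simp only at haS ⊢
        exact_mod_cast haS
      · have := (hA T).2 ⟨a, haA, rfl⟩
        simp only at this ⊢
        exact_mod_cast this
    rw [← NNReal.coe_inj, NNReal.coe_sum]
    simp only [Real.coe_toNNReal _ (hnn _ _ _)]
    exact (hsC S v hex).2.1

/-! ### Sampling a request from the ex-ante solution -/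

/-- The uniform distribution on `[0, 1)`. -/
noncomputable def uniformLaw : Measure ℝ := volume.restrict (Set.Ico 0 1)

instance : IsProbabilityMeasure uniformLaw :=
  ⟨by simp [uniformLaw]⟩

section Sampling

variable {ι : Type*} [Fintype ι] (e : ι ≃ Fin (Fintype.card ι))

/-- Consecutive intervals of lengths `x S`, starting from `0`. -/
noncomputable def sampleInterval (x : ι → ℝ≥0) (S : ι) : Set ℝ :=
  Set.Ico ((∑ S' with e S' < e S, x S' : ℝ≥0) : ℝ) ((∑ S' with e S' ≤ e S, x S' : ℝ≥0) : ℝ)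

lemma measurableSet_sampleInterval (x : ι → ℝ≥0) (S : ι) :
    MeasurableSet (sampleInterval e x S) :=
  measurableSet_Ico

lemma sum_filter_le_eq (x : ι → ℝ≥0) (S : ι) :
    ∑ S' with e S' ≤ e S, x S' = ∑ S' with e S' < e S, x S' + x S := by
  classical
  have : (Finset.univ.filter fun S' => e S' ≤ e S) =
      insert S (Finset.univ.filter fun S' => e S' < e S) := by
    ext S'
    simp only [Finset.mem_filter, Finset.mem_univ, true_and, Finset.mem_insert, le_iff_eq_or_lt,
      e.injective.eq_iff]
  rw [this, Finset.sum_insert (by simp), add_comm]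

lemma volume_sampleInterval (x : ι → ℝ≥0) (S : ι) : volume (sampleInterval e x S) = x S := by
  rw [sampleInterval, Real.volume_Ico, sum_filter_le_eq, NNReal.coe_add, add_sub_cancel_left,
    ENNReal.ofReal_coe_nnreal]

lemma uniformLaw_sampleInterval_le (x : ι → ℝ≥0) (S : ι) :
    uniformLaw (sampleInterval e x S) ≤ x S :=
  (Measure.restrict_apply_le _ _).trans (volume_sampleInterval e x S).le

lemma uniformLaw_sampleInterval {x : ι → ℝ≥0} (hx : ∑ S, x S ≤ 1) (S : ι) :
    uniformLaw (sampleInterval e x S) = x S := by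
  rw [uniformLaw, Measure.restrict_apply (measurableSet_sampleInterval e x S), Set.inter_eq_left.2,
    volume_sampleInterval]
  refine Set.Ico_subset_Ico (NNReal.coe_nonneg _) ?_
  exact_mod_cast (Finset.sum_le_sum_of_subset (Finset.filter_subset _ _)).trans hx

lemma sampleInterval_disjoint (x : ι → ℝ≥0) {S S' : ι} {u : ℝ} (h : u ∈ sampleInterval e x S)
    (h' : u ∈ sampleInterval e x S') : S = S' := by
  have key : ∀ {S S' : ι}, u ∈ sampleInterval e x S → u ∈ sampleInterval e x S' →
      ¬ e S < e S' := by
    intro S S' h h' hlt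
    have h1 : ∑ T with e T ≤ e S, x T ≤ ∑ T with e T < e S', x T := by
      refine Finset.sum_le_sum_of_subset fun T hT => ?_
      simp only [Finset.mem_filter, Finset.mem_univ, true_and] at hT ⊢
      exact hT.trans_lt hlt
    have h2 : ((∑ T with e T ≤ e S, x T : ℝ≥0) : ℝ) ≤ (∑ T with e T < e S', x T : ℝ≥0) := by
      exact_mod_cast h1
    exact absurd (h.2.trans_le (h2.trans h'.1)) (lt_irrefl _)
  exact e.injective (le_antisymm (not_lt.1 (key h' h)) (not_lt.1 (key h h')))

end Sampling

/-- One buyer: a random request, drawn according to the ex-ante solution and priced by supporting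
additive functions. `X j (v, u)` is the value of item `j` to the buyer. -/
theorem exists_item_values {m : ℕ} {D : Measure (BuyerValuation m)} [IsProbabilityMeasure D]
    (hXOS : ∀ᵐ v ∂D, IsXOS v) {x : BuyerValuation m → Finset (Fin m) → ℝ≥0}
    (hx : ∀ S, Measurable fun v => x v S) (hx1 : ∀ᵐ v ∂D, ∑ S, x v S ≤ 1) :
    ∃ X : Fin m → BuyerValuation m × ℝ → ℝ≥0, (∀ j, Measurable (X j)) ∧
      (∀ z T, ∑ j ∈ T, X j z ≤ z.1 T) ∧
      (∀ j, D.prod uniformLaw {z | X j z ≠ 0} ≤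
        ∑ S : Finset (Fin m) with j ∈ S, ∫⁻ v, (x v S : ℝ≥0∞) ∂D) ∧
      ∑ S : Finset (Fin m), ∫⁻ v, (v S : ℝ≥0∞) * (x v S : ℝ≥0∞) ∂D ≤
        ∑ j, ∫⁻ z, X j z ∂(D.prod uniformLaw) := by
  classical
  obtain ⟨a, ham, hale, haeq⟩ := exists_measurable_support m
  let e := Fintype.equivFin (Finset (Fin m))
  let I : Finset (Fin m) → Set (BuyerValuation m × ℝ) := fun S =>
    {z | z.2 ∈ sampleInterval e (x z.1) S}
  have hIm : ∀ S, MeasurableSet (I S) := fun S => by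
    have h1 : ∀ F : Finset (Finset (Fin m)), Measurable fun z : BuyerValuation m × ℝ =>
        ((∑ S' ∈ F, x z.1 S' : ℝ≥0) : ℝ) := fun F =>
      ((Finset.measurable_fun_sum F fun S' _ => hx S').comp measurable_fst).coe_nnreal_real
    exact (measurableSet_le (h1 _) measurable_snd).inter (measurableSet_lt measurable_snd (h1 _))
  have hdisj : ∀ {S S' z}, z ∈ I S → z ∈ I S' → S = S' := fun h h' =>
    sampleInterval_disjoint e _ h h'
  let X : Fin m → BuyerValuation m × ℝ → ℝ≥0 := fun j z =>
    ∑ S : Finset (Fin m) with j ∈ S, (I S).indicator (fun z => a z.1 S j) z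
  have ham' : ∀ S j, Measurable fun z : BuyerValuation m × ℝ => a z.1 S j := fun S j =>
    (ham S j).comp measurable_fst
  refine ⟨X, fun j => Finset.measurable_fun_sum _ fun S _ => (ham' S j).indicator (hIm S),
    fun z T => ?_, fun j => ?_, ?_⟩
  · by_cases hz : ∃ S, z ∈ I S
    · obtain ⟨S, hS⟩ := hz
      refine (Finset.sum_le_sum fun j _ => ?_).trans (hale z.1 S T)
      have h1 : ∀ S' ≠ S, (I S').indicator (fun z => a z.1 S' j) z = 0 := fun S' hS' =>
        Set.indicator_of_notMem (fun h => hS' (hdisj h hS)) _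
      refine (Finset.sum_le_sum_of_subset (Finset.filter_subset _ _)).trans (le_of_eq ?_)
      rw [Finset.sum_eq_single S (fun S' _ h => h1 S' h) (by simp), Set.indicator_of_mem hS]
    · have h1 : ∀ j, X j z = 0 := fun j => Finset.sum_eq_zero fun S _ =>
        Set.indicator_of_notMem (fun h => hz ⟨S, h⟩) _
      simp [h1]
  · have hsub : {z | X j z ≠ 0} ⊆ ⋃ S ∈ Finset.univ.filter fun S : Finset (Fin m) => j ∈ S, I S := by
      intro z hz
      obtain ⟨S, hS, hne⟩ := Finset.exists_ne_zero_of_sum_ne_zero hz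
      exact Set.mem_biUnion hS (Set.mem_of_indicator_ne_zero hne)
    refine (measure_mono hsub).trans ((measure_biUnion_finset_le _ _).trans
      (Finset.sum_le_sum fun S _ => ?_))
    rw [Measure.prod_apply (hIm S)]
    -- Clipping to `[0, 1)` only shortens intervals, so this bound needs no condition on the total
    -- of `x v`.
    exact lintegral_mono fun v => uniformLaw_sampleInterval_le e (x v) S
  · have h1 : ∀ j, ∫⁻ z, X j z ∂(D.prod uniformLaw) =
        ∑ S : Finset (Fin m), ∫⁻ v, (if j ∈ S then (a v S j : ℝ≥0∞) else 0) * x v S ∂D := by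
      intro j
      have hind : ∀ S, Measurable ((I S).indicator fun z => (a z.1 S j : ℝ≥0∞)) := fun S =>
        (ham' S j).coe_nnreal_ennreal.indicator (hIm S)
      simp only [X, ENNReal.ofNNReal_finsetSum, ENNReal.coe_indicator]
      rw [lintegral_finsetSum _ fun S _ => hind S, Finset.sum_filter]
      refine Finset.sum_congr rfl fun S _ => ?_
      split_ifs with hj
      · rw [lintegral_prod _ (hind S).aemeasurable]
        refine lintegral_congr_ae ?_
        filter_upwards [hx1] with v hv
        have h2 : (fun u => (I S).indicator (fun z => (a z.1 S j : ℝ≥0∞)) (v, u)) =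
            (sampleInterval e (x v) S).indicator fun _ => (a v S j : ℝ≥0∞) := by
          funext u
          simp [Set.indicator, I]
        rw [h2, lintegral_indicator (measurableSet_sampleInterval e _ S), setLIntegral_const,
          uniformLaw_sampleInterval e hv]
      · simp
    rw [Finset.sum_congr rfl fun j _ => h1 j, Finset.sum_comm]
    refine Finset.sum_le_sum fun S _ => ?_
    have h3 : ∀ j, Measurable fun v => (if j ∈ S then (a v S j : ℝ≥0∞) else 0) * x v S := fun j =>
      Measurable.mul (by split_ifs; exacts [(ham S j).coe_nnreal_ennreal, measurable_const])
        (hx S).coe_nnreal_ennreal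
    rw [← lintegral_finsetSum _ fun j _ => h3 j]
    refine lintegral_mono_ae ?_
    filter_upwards [hXOS] with v hv
    rw [← Finset.sum_mul, ← haeq v S hv, ← Finset.sum_filter]
    simp

/-! ### The mechanism: one booking scheme per item -/

section Mechanism

variable {n m : ℕ} (B : Fin m → BookingScheme n (BuyerValuation m × ℝ))

/-- The class with respect to item `j` of the buyer in position `s` of a history. -/
def historyClass {t : ℕ} (ω : Fin n → ℝ) (h : Fin (t + 1) → Fin n × BuyerValuation m)
    (j : Fin m) (s : Fin (t + 1)) : ℕ :=
  (B j).cls (h s).1 ((h s).2, ω (h s).1)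

/-- The available items whose booking scheme accepts the last of the requests with the classes
`g`. -/
def bookedItems (R : Fin m → ℕ) {t : ℕ} (g : Fin m → Fin (t + 1) → ℕ) : Finset (Fin m) :=
  Finset.univ.filter fun j => 0 < R j ∧ Accepts (B j).limit (B j).classes
    (fun s => if h : s < t + 1 then g j ⟨s, h⟩ else 0) t

/-- Each item is sold by its own booking scheme. -/
noncomputable def bookingMechanism : OnlineMechanism n m where
  Seed := Fin n → ℝ
  law := Measure.pi fun _ => uniformLaw
  alloc := fun ω R _ h => bookedItems B R (historyClass B ω h)
  alloc_available := fun ω R t h j hj => (Finset.mem_filter.1 hj).2.1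
  measurableSet_alloc := fun R t b T => by
    have h1 : Measurable fun (p : (Fin n → ℝ) × (Fin (t + 1) → BuyerValuation m)) =>
        historyClass B p.1 fun s => (b s, p.2 s) := by
      refine measurable_pi_lambda _ fun j => measurable_pi_lambda _ fun s => ?_
      exact ((B j).measurable_cls (b s)).comp
        (((measurable_pi_apply s).comp measurable_snd).prodMk
          ((measurable_pi_apply (b s)).comp measurable_fst))
    exact h1 (MeasurableSet.of_discrete (s := {g | bookedItems B R g = T}))

variable {B} {K : Fin m → ℕ}

/-- Values and seeds of the buyers. -/
def buyerData (v : Fin n → BuyerValuation m) (ω : Fin n → ℝ) (i : Fin n) : BuyerValuation m × ℝ :=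
  (v i, ω i)

lemma mem_serve_iff (ω : Fin n → ℝ) (v : Fin n → BuyerValuation m) (π : Equiv.Perm (Fin n))
    (R : Fin m → ℕ) (t : ℕ) (ht : t < n) (j : Fin m) :
    j ∈ (bookingMechanism B).serve ω v π R t ht ↔ 0 < R j ∧
      Accepts (B j).limit (B j).classes ((B j).arrival (buyerData v ω) π) t := by
  change j ∈ bookedItems B R _ ↔ _
  unfold bookedItems
  simp only [Finset.mem_filter, Finset.mem_univ, true_and]
  have h1 : ∀ s < t + 1, (fun s => if h : s < t + 1 then historyClass B ω (fun s : Fin (t + 1) =>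
      (π ⟨s, lt_of_lt_of_le s.isLt ht⟩, v (π ⟨s, lt_of_lt_of_le s.isLt ht⟩))) j ⟨s, h⟩ else 0) s =
      (B j).arrival (buyerData v ω) π s := by
    intro s hs
    simp only [dif_pos hs, BookingScheme.arrival, dif_pos (hs.trans_le ht), historyClass, buyerData]
  unfold Accepts
  rw [classCount_congr h1, classCount_congr fun s hs => h1 s (Nat.lt_succ_of_lt hs)]

/-- Since limits never exceed the supply, acceptance implies that a copy is left. The availability
test in `bookedItems` therefore never changes a decision, and the items do not interact. -/
lemma remaining_bookingMechanism (hB : ∀ j p, (B j).limit p ≤ K j) (ω : Fin n → ℝ)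
    (v : Fin n → BuyerValuation m) (π : Equiv.Perm (Fin n)) (t : ℕ) (ht : t ≤ n) (j : Fin m) :
    (bookingMechanism B).remaining K ω v π t ht j =
      K j - soldBelow (B j).limit (classCount ((B j).arrival (buyerData v ω) π) t)
        (B j).classes := by
  induction t with
  | zero =>
    have : classCount ((B j).arrival (buyerData v ω) π) 0 = fun _ => 0 :=
      funext (classCount_zero _)
    simp [OnlineMechanism.remaining, this, soldBelow_zero]
  | succ t ih =>
    simp only [OnlineMechanism.remaining, mem_serve_iff, ih (Nat.le_of_succ_le ht)]
    have h1 := soldBelow_classCount_succ (B j).limit (B j).classes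
      ((B j).arrival (buyerData v ω) π) t
    have h2 := soldBelow_le (hB j) (classCount ((B j).arrival (buyerData v ω) π) (t + 1))
      (B j).classes
    by_cases ha : Accepts (B j).limit (B j).classes ((B j).arrival (buyerData v ω) π) t
    · rw [if_pos ha] at h1
      rw [if_pos ⟨by omega, ha⟩]
      omega
    · rw [if_neg ha] at h1
      rw [if_neg fun h => ha h.2]
      omega

lemma mem_bundle_iff (hB : ∀ j p, (B j).limit p ≤ K j) (ω : Fin n → ℝ)
    (v : Fin n → BuyerValuation m) (π : Equiv.Perm (Fin n)) (t : Fin n) (j : Fin m) :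
    j ∈ (bookingMechanism B).bundle K ω v π t ↔
      Accepts (B j).limit (B j).classes ((B j).arrival (buyerData v ω) π) t := by
  unfold OnlineMechanism.bundle
  rw [mem_serve_iff, remaining_bookingMechanism hB]
  refine ⟨fun h => h.2, fun ha => ⟨?_, ha⟩⟩
  have h1 := soldBelow_classCount_succ (B j).limit (B j).classes
    ((B j).arrival (buyerData v ω) π) t
  have h2 := soldBelow_le (hB j) (classCount ((B j).arrival (buyerData v ω) π) (t + 1))
    (B j).classes
  rw [if_pos ha] at h1
  omega

lemma sum_acceptedValue_le_runWelfare (hB : ∀ j p, (B j).limit p ≤ K j)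
    {X : Fin n → Fin m → BuyerValuation m × ℝ → ℝ≥0}
    (hX : ∀ i z T, ∑ j ∈ T, X i j z ≤ z.1 T) (ω : Fin n → ℝ) (v : Fin n → BuyerValuation m)
    (π : Equiv.Perm (Fin n)) :
    ∑ j, (B j).acceptedValue (fun i => X i j) (buyerData v ω) π ≤
      (bookingMechanism B).runWelfare K ω v π := by
  unfold BookingScheme.acceptedValue OnlineMechanism.runWelfare
  rw [Finset.sum_comm]
  refine Finset.sum_le_sum fun t _ => ?_
  refine le_trans (le_of_eq ?_) (hX (π t) (buyerData v ω (π t)) _)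
  rw [← Finset.sum_filter]
  refine Finset.sum_congr (Finset.ext fun j => ?_) fun _ _ => rfl
  rw [mem_bundle_iff hB]
  simp

end Mechanism

/-- The data of a buyer are the pairs of value and seed, with law `(D i).prod uniformLaw`. For fixed
buyers the data are independent, so each item's scheme applies; the same seed serves all items,
which is harmless because only expectations are added. -/
theorem mainTheorem5 (n m : ℕ) (D : Fin n → Measure (BuyerValuation m))
    (hD : ∀ i, IsProbabilityMeasure (D i)) (hXOS : ∀ i, ∀ᵐ v ∂(D i), IsXOS v)
    (K : Fin m → ℕ) (hK : ∀ j, 0 < K j)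
    (k : ℕ) (hk : IsLeast (Set.range K) k)
    (x : Fin n → BuyerValuation m → Finset (Fin m) → ℝ≥0) (hx : IsExAnteFeasible D K x) :
    ∃ M : OnlineMechanism n m,
      ENNReal.ofReal (1 - 1 / Real.sqrt ((k : ℝ) + 3)) * exAnteObjective D x ≤
        M.welfare D K := by
  choose X hXm hXle hX0 hXobj using fun i =>
    exists_item_values (hXOS i) (hx.measurable i) (hx.total_le_one i)
  have hsupply : ∀ j, ∑ i, (D i).prod uniformLaw {z | X i j z ≠ 0} ≤ K j := fun j =>
    (Finset.sum_le_sum fun i _ => hX0 i j).trans (hx.supply j)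
  choose B hBK L hLm hL hLe using fun j =>
    exists_guarantees (μ := fun i => (D i).prod uniformLaw) (fun i => hXm i j) (hK j) (hsupply j)
  refine ⟨bookingMechanism B, ?_⟩
  have hmp := measurePreserving_arrowProdEquivProdArrow (BuyerValuation m) ℝ (Fin n) D
    fun _ => uniformLaw
  have hpair : ∀ j, Measurable fun p : (Fin n → BuyerValuation m) × (Fin n → ℝ) =>
      L j (buyerData p.1 p.2) := fun j => by
    refine (hLm j).comp (measurable_pi_lambda _ fun i => ?_)
    exact ((measurable_pi_apply i).comp measurable_fst).prodMk
      ((measurable_pi_apply i).comp measurable_snd)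
  have hLint : ∀ j, ∫⁻ v, ∫⁻ ω, L j (buyerData v ω) ∂(Measure.pi fun _ => uniformLaw)
      ∂(Measure.pi D) = ∫⁻ z, L j z ∂(Measure.pi fun i => (D i).prod uniformLaw) := fun j => by
    rw [← lintegral_prod _ (hpair j).aemeasurable, ← hmp.lintegral_comp (hpair j)]
    rfl
  have hγ : ∀ j, ENNReal.ofReal (1 - 1 / Real.sqrt ((k : ℝ) + 3)) ≤
      ENNReal.ofReal (1 - 1 / Real.sqrt ((K j : ℝ) + 3)) := fun j => by
    have h1 : (k : ℝ) ≤ K j := by exact_mod_cast hk.2 ⟨j, rfl⟩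
    refine ENNReal.ofReal_le_ofReal (sub_le_sub_left (one_div_le_one_div_of_le
      (Real.sqrt_pos.2 (by positivity)) (Real.sqrt_le_sqrt (by linarith))) _)
  calc ENNReal.ofReal (1 - 1 / Real.sqrt ((k : ℝ) + 3)) * exAnteObjective D x
      ≤ ENNReal.ofReal (1 - 1 / Real.sqrt ((k : ℝ) + 3)) *
          ∑ i, ∑ j, ∫⁻ z, X i j z ∂((D i).prod uniformLaw) := by
        unfold exAnteObjective
        gcongr with i
        exact hXobj i
    _ = ∑ j, ENNReal.ofReal (1 - 1 / Real.sqrt ((k : ℝ) + 3)) *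
          ∑ i, ∫⁻ z, X i j z ∂((D i).prod uniformLaw) := by
        rw [Finset.sum_comm, Finset.mul_sum]
    _ ≤ ∑ j, ∫⁻ z, L j z ∂(Measure.pi fun i => (D i).prod uniformLaw) :=
        Finset.sum_le_sum fun j _ => (mul_le_mul_left (hγ j) _).trans (hLe j)
    _ = ∫⁻ v, ∫⁻ ω, ∑ j, L j (buyerData v ω) ∂(Measure.pi fun _ => uniformLaw)
          ∂(Measure.pi D) := by
        rw [Finset.sum_congr rfl fun j _ => (hLint j).symm,
          ← lintegral_finsetSum _ fun j _ => (hpair j).lintegral_prod_right']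
        refine lintegral_congr fun v => ?_
        have hv : ∀ j, Measurable fun ω => L j (buyerData v ω) := fun j =>
          (hpair j).comp measurable_prodMk_left
        rw [lintegral_finsetSum _ fun j _ => hv j]
    _ ≤ (bookingMechanism B).welfare D K := by
        unfold OnlineMechanism.welfare
        -- The bounds `L j` do not depend on the order, so they pass under the infimum over `π`.
        refine lintegral_mono fun v => le_iInf fun π => lintegral_mono fun ω => ?_
        refine (Finset.sum_le_sum fun j _ => hL j (buyerData v ω) π).trans ?_
        have := sum_acceptedValue_le_runWelfare hBK hXle ω v π
        exact_mod_cast this
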